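/- **Model.** There are $L$ users, $S$ contexts and $A$ actions; rewards lie in $\{0,1\}$. A Bernoulli contextual bandit $\mathcal B$ consists of a context law $\nu$ on $[S]$ and, for every $(s,a)$, a Bernoulli reward law with mean $\mu(s,a)$. A policy is a map $\pi:[S]\to\Delta([A])$, with value $V^\pi=\sum_s\nu(s)\sum_a\pi(a\mid s)\mu(s,a)$; put $V^*=\sup_\pi V^\pi$ and call $\pi$ $\epsilon$-optimal if $V^*-V^\pi\le\epsilon$. A multi-user system consists of $\mathcal B$, a set $\mathcal I^*\subseteq[L]$ of good users, and an adversary; it is $\alpha$-corrupted if $|\mathcal I^*|\ge(1-\alpha)L$. At step $t$ a user $i_t$ arrives. If $i_t\in\mathcal I^*$, its context $s_t$ is drawn from $\nu$, the algorithm picks an action $a_t$, and the reward is drawn from the reward law of $\mathcal B$ at $(s_t,a_t)$. If $i_t\notin\mathcal I^*$, the adversary chooses $s_t$, and then, having seen $a_t$, the reward, both possibly at random and depending on the whole history of all users. A (randomized) algorithm chooses $a_t$ from the history, $i_t$ and $s_t$, without knowing $\mathcal I^*$ or $\mathcal B$; after $T$ steps it returns a (possibly random) policy depending on the history. **Theorem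 (lower bound).** Let $\beta>0$ and $0<\eta<\beta/2$. There is $c=c(\beta,\eta)>0$ such that for every $C>0$ there is $m_0$ with the following property. Let $m=\min(S,A)\ge m_0$, $\alpha<1/3$, $\epsilon>0$, and suppose that $$\log L\le m^{\eta}\qquad\text{and}\qquad \epsilon\Big(1+\frac{\log L}{\log m}\Big)\le c\,\alpha .$$ Then there is a set $\mathcal H$ of $\alpha$-corrupted multi-user systems with $L$ users, $S$ contexts, $A$ actions, uniform $\nu$ and Bernoulli rewards such that, for every arrival sequence $(i_t)$, every $T$ and every algorithm, if each user is visited at most $$C\,\min(S,A)^{1-\beta}\,\frac{\alpha^2}{\epsilon^2}$$ times during the first $T$ steps, then on some system in $\mathcal H$ the returned policy is $\epsilon$-optimal for $\mathcal B$ with probability at most $2/3$. (The number of users may thus be any polynomial in $S$, $A$ and $1/\epsilon$ whose logarithm is at most $m^\eta$. For example, for fixed $K$ and $L\le m^K$, the first condition holds once $m$ is large, and the second follows from $\epsilon\le\frac{c}{1+K}\alpha$.) -/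

import Mathlib

open MeasureTheory
open scoped ENNReal

/-- One interaction: the arriving user, the revealed context, the chosen action, and the binary
reward (`true` is reward `1`, `false` is reward `0`). -/
structure BanditStep (S A L : ℕ) where
  user : Fin L
  context : Fin S
  action : Fin A
  reward : Bool

/-- The interaction history (of all users), most recent step first. -/
abbrev BanditHistory (S A L : ℕ) : Type := List (BanditStep S A L)

/-- Stationary randomized policies `π : 𝒮 → Δ(𝒜)`. -/
abbrev BanditPolicy (S A : ℕ) : Type := Fin S → stdSimplex ℝ (Fin A)

/-- A contextual bandit with `S` contexts, `A` actions and Bernoulli rewards: the context law `ν`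
and the reward laws `R(s,a)`, which are arbitrary laws on `{0,1}`. -/
structure BernoulliBandit (S A : ℕ) where
  contextLaw : PMF (Fin S)
  rewardLaw : Fin S → Fin A → PMF Bool

namespace BernoulliBandit

variable {S A : ℕ}

/-- The mean reward `μ(s,a)`. -/
noncomputable def mean (B : BernoulliBandit S A) (s : Fin S) (a : Fin A) : ℝ :=
  (B.rewardLaw s a true).toReal

/-- The expected reward `V^π` of a policy. -/
noncomputable def value (B : BernoulliBandit S A) (π : BanditPolicy S A) : ℝ :=
  ∑ s, (B.contextLaw s).toReal * ∑ a, (π s).1 a * B.mean s a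

/-- The optimal expected reward `V^*`. -/
noncomputable def optValue (B : BernoulliBandit S A) : ℝ :=
  ⨆ π : BanditPolicy S A, B.value π

/-- The set of `ε`-optimal policies, `V^* - V^π ≤ ε`. -/
def nearOptimal (B : BernoulliBandit S A) (ε : ℝ) : Set (BanditPolicy S A) :=
  {π | B.optValue - B.value π ≤ ε}

end BernoulliBandit

/-- A multi-user system with `L` users. Users in `good` follow the common bandit. All other users
are controlled by one coordinated adversary: when user `i` outside `good` arrives, the adversary
draws its context from `advContext h i` and, after seeing the action, its reward from
`advReward h i s a`, where `h` is the complete history of all users. -/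
structure MultiUserSystem (S A L : ℕ) where
  good : Finset (Fin L)
  bandit : BernoulliBandit S A
  advContext : BanditHistory S A L → Fin L → PMF (Fin S)
  advReward : BanditHistory S A L → Fin L → Fin S → Fin A → PMF Bool

/-- A (randomized) algorithm: the law of the action played for an arriving user with a given
context, after a given history, and the law of the policy returned after a given history. It does
not see which users are good. -/
structure BanditAlgorithm (S A L : ℕ) where
  act : BanditHistory S A L → Fin L → Fin S → PMF (Fin A)
  output : BanditHistory S A L → ProbabilityMeasure (BanditPolicy S A)

namespace MultiUserSystem

variable {S A L : ℕ}

/-- At least a `(1 - α)`-fraction of the users is good. -/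
def IsCorrupted (M : MultiUserSystem S A L) (α : ℝ) : Prop :=
  (1 - α) * (L : ℝ) ≤ (M.good.card : ℝ)

/-- The law of the context revealed by user `i` after history `h`. -/
noncomputable def contextStep (M : MultiUserSystem S A L) (h : BanditHistory S A L) (i : Fin L) :
    PMF (Fin S) :=
  if i ∈ M.good then M.bandit.contextLaw else M.advContext h i

/-- The law of the reward returned by user `i` in context `s` for action `a` after history `h`. -/
noncomputable def rewardStep (M : MultiUserSystem S A L) (h : BanditHistory S A L) (i : Fin L)
    (s : Fin S) (a : Fin A) : PMF Bool :=
  if i ∈ M.good then M.bandit.rewardLaw s a else M.advReward h i s a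

/-- The law of the history after the first `t` steps, if user `arrival k` arrives at step `k`. -/
noncomputable def historyLaw (M : MultiUserSystem S A L) (alg : BanditAlgorithm S A L)
    (arrival : ℕ → Fin L) : ℕ → PMF (BanditHistory S A L)
  | 0 => PMF.pure []
  | t + 1 =>
    (M.historyLaw alg arrival t).bind fun h =>
      (M.contextStep h (arrival t)).bind fun s =>
        (alg.act h (arrival t) s).bind fun a =>
          (M.rewardStep h (arrival t) s a).bind fun r =>
            PMF.pure (⟨arrival t, s, a, r⟩ :: h)

/-- The probability that the policy returned after `T` steps is `ε`-optimal for the good users. -/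
noncomputable def successProb (M : MultiUserSystem S A L) (alg : BanditAlgorithm S A L)
    (arrival : ℕ → Fin L) (T : ℕ) (ε : ℝ) : ℝ≥0∞ :=
  ∑' h, M.historyLaw alg arrival T h *
    (alg.output h : Measure (BanditPolicy S A)) (M.bandit.nearOptimal ε)

end MultiUserSystem

/-- The number of interactions with user `i` during the first `T` steps. -/
def numInteractions {L : ℕ} (arrival : ℕ → Fin L) (T : ℕ) (i : Fin L) : ℕ :=
  ((Finset.range T).filter fun t => arrival t = i).card

/-! Plant a uniformly random action `v s` in every context `s`, with mean (1 + δ)/2 against 1/2 for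
all other actions, where δ = 4ε. An ε-optimal policy must give the planted actions average weight at
least 1/2. Let every user be bad independently with probability p = α/2. A bad user tilts the
rewards of planted actions in the opposite direction, so that the mixture of the good and the bad
behaviour of that user is a sequence of fair coins (`mixture_eq_one`). Likelihood ratios depend on
each user's own interactions only, so the mixture over all sets of good users is a product over
users (`density_hidingWeight`, `sum_prod_ite_mem`). While hiding works, the algorithm sees fair
coins that carry no information on `v` (`sum_goodPrior_mul_historyMean_le`), and a policy found from
these is near-optimal for a fraction at most 2/A of the `v` (`sum_measure_nearOptimal_le`).

Hiding fails for a user only if the ±1 walk `score` of its rewards on planted actions exceeds x =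
p/(2δ) = α/(16ε) (`exists_score_gt_of_not_hideable`). The walk moves only when `v` is hit, and hits
are rare: contexts cannot be chosen and the planted action must be guessed. For N ≤ R · min(S, A)
visits, the mean of (1 + 1/R)^hits over `v` and histories is at most e²
(`sum_historyMean_pow_hitCount_le`). So a score above x is unlikely, either because it needs x hits,
or by the maximal sub-Gaussian inequality for a walk with few steps
(`historyMean_exists_score_gt_le`). `exists_constants` shows that one of the two always makes the
failure probability O(1/L) per user, which a union bound can afford.

The average success is thus at most 2/A + 1/5 < 1/3. Success above 2/3 on every α-corrupted system
would force at least 1/3, since at most αL users are bad with probability at least 1/2. -/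

/-! ### Expectations of functions of the history -/

theorem PMF.tsum_bind_mul {α β : Type*} (p : PMF α) (q : α → PMF β) (F : β → ℝ≥0∞) :
    ∑' b, (p.bind q) b * F b = ∑' a, p a * ∑' b, q a b * F b := by
  simp_rw [PMF.bind_apply, ← ENNReal.tsum_mul_right, ← ENNReal.tsum_mul_left]
  rw [ENNReal.tsum_comm]
  simp_rw [mul_assoc]

theorem PMF.tsum_pure_mul {α : Type*} (a : α) (F : α → ℝ≥0∞) :
    ∑' b, (PMF.pure a) b * F b = F a := by
  rw [tsum_eq_single a]
  · simp
  · intro b hb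
    simp [PMF.pure_apply, hb]

theorem PMF.sum_toReal {α : Type*} [Fintype α] (p : PMF α) : ∑ a, (p a).toReal = 1 := by
  rw [← ENNReal.toReal_sum (fun a _ => p.apply_ne_top a), ← tsum_fintype (L := .unconditional α),
    p.tsum_coe, ENNReal.toReal_one]

section Expect

variable {S A L : ℕ}

/-- Mean of `f` after one more interaction with user `i`, for uniform contexts, actions of `alg`
and reward probabilities `w`. -/
noncomputable def stepMean (w : BanditHistory S A L → Fin L → Fin S → Fin A → Bool → ℝ)
    (alg : BanditAlgorithm S A L) (i : Fin L) (f : BanditHistory S A L → ℝ)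
    (h : BanditHistory S A L) : ℝ :=
  (S : ℝ)⁻¹ * ∑ s, ∑ a, (alg.act h i s a).toReal * ∑ r, w h i s a r * f (⟨i, s, a, r⟩ :: h)

/-- Mean of `f` over histories of length `t`, for uniform contexts, actions of `alg` and reward
probabilities `w`. -/
noncomputable def historyMean (w : BanditHistory S A L → Fin L → Fin S → Fin A → Bool → ℝ)
    (alg : BanditAlgorithm S A L) (arrival : ℕ → Fin L) : ℕ → (BanditHistory S A L → ℝ) → ℝ
  | 0, f => f []
  | t + 1, f => historyMean w alg arrival t (stepMean w alg (arrival t) f)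

/-- Reward probabilities of fair coins. -/
noncomputable def fairWeight : BanditHistory S A L → Fin L → Fin S → Fin A → Bool → ℝ :=
  fun _ _ _ _ _ => 1 / 2

variable {w : BanditHistory S A L → Fin L → Fin S → Fin A → Bool → ℝ}
  {alg : BanditAlgorithm S A L} {arrival : ℕ → Fin L}

theorem stepMean_mono (hw : ∀ h i s a r, 0 ≤ w h i s a r) {i : Fin L}
    {f g : BanditHistory S A L → ℝ} {h : BanditHistory S A L}
    (hfg : ∀ s a r, f (⟨i, s, a, r⟩ :: h) ≤ g (⟨i, s, a, r⟩ :: h)) :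
    stepMean w alg i f h ≤ stepMean w alg i g h := by
  unfold stepMean
  gcongr with s _ a _ r _
  · exact hw _ _ _ _ _
  · exact hfg s a r

theorem historyMean_mono (hw : ∀ h i s a r, 0 ≤ w h i s a r) (t : ℕ)
    {f g : BanditHistory S A L → ℝ} (hfg : ∀ h, f h ≤ g h) :
    historyMean w alg arrival t f ≤ historyMean w alg arrival t g := by
  induction t generalizing f g with
  | zero => exact hfg []
  | succ t ih => exact ih fun h => stepMean_mono hw fun s a r => hfg _

theorem historyMean_add (t : ℕ) (f g : BanditHistory S A L → ℝ) :
    historyMean w alg arrival t (fun h => f h + g h) =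
      historyMean w alg arrival t f + historyMean w alg arrival t g := by
  induction t generalizing f g with
  | zero => rfl
  | succ t ih =>
    simp only [historyMean]
    rw [← ih]
    congr 1
    funext h
    simp only [stepMean, mul_add, Finset.sum_add_distrib]

theorem historyMean_const_mul (t : ℕ) (c : ℝ) (f : BanditHistory S A L → ℝ) :
    historyMean w alg arrival t (fun h => c * f h) = c * historyMean w alg arrival t f := by
  induction t generalizing f with
  | zero => rfl
  | succ t ih =>
    simp only [historyMean]
    rw [← ih]
    congr 1
    funext h
    simp only [stepMean, Finset.mul_sum]
    refine Finset.sum_congr rfl fun s _ => Finset.sum_congr rfl fun a _ =>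
      Finset.sum_congr rfl fun r _ => by ring

theorem historyMean_zero (t : ℕ) :
    historyMean w alg arrival t (fun _ => (0 : ℝ)) = 0 := by
  have := historyMean_const_mul (w := w) (alg := alg) (arrival := arrival) t 0 (fun _ => 0)
  simpa using this

theorem historyMean_sum {ι : Type*} (t : ℕ) (J : Finset ι) (f : ι → BanditHistory S A L → ℝ) :
    historyMean w alg arrival t (fun h => ∑ j ∈ J, f j h) =
      ∑ j ∈ J, historyMean w alg arrival t (f j) := by
  classical
  induction J using Finset.induction_on with
  | empty => simpa using historyMean_zero t
  | insert j J hj ih =>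
    simp only [Finset.sum_insert hj]
    rw [historyMean_add, ih]

theorem stepMean_const [NeZero S] (hw : ∀ h i s a, ∑ r, w h i s a r = 1) (i : Fin L) (c : ℝ)
    (h : BanditHistory S A L) : stepMean w alg i (fun _ => c) h = c := by
  have hS : (S : ℝ) ≠ 0 := Nat.cast_ne_zero.mpr (NeZero.ne S)
  simp only [stepMean, ← Finset.sum_mul, hw, PMF.sum_toReal, one_mul, Finset.sum_const,
    Finset.card_univ, Fintype.card_fin, nsmul_eq_mul]
  field_simp

theorem historyMean_const [NeZero S] (hw : ∀ h i s a, ∑ r, w h i s a r = 1) (t : ℕ) (c : ℝ) :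
    historyMean w alg arrival t (fun _ => c) = c := by
  induction t with
  | zero => rfl
  | succ t ih =>
    have : stepMean w alg (arrival t) (fun _ => c) = fun _ => c :=
      funext fun h => stepMean_const hw _ c h
    simp only [historyMean, this, ih]

theorem fairWeight_nonneg (h : BanditHistory S A L) (i : Fin L) (s : Fin S) (a : Fin A)
    (r : Bool) : 0 ≤ fairWeight h i s a r := by
  unfold fairWeight; norm_num

theorem sum_fairWeight (h : BanditHistory S A L) (i : Fin L) (s : Fin S) (a : Fin A) :
    ∑ r, fairWeight h i s a r = 1 := by
  simp [fairWeight]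

/-- The likelihood ratio of a history with respect to fair rewards. -/
noncomputable def density (w : BanditHistory S A L → Fin L → Fin S → Fin A → Bool → ℝ) :
    BanditHistory S A L → ℝ
  | [] => 1
  | x :: h => density w h * (2 * w h x.user x.context x.action x.reward)

/-- Change of measure: contexts and actions have the same law on both sides and cancel, so only
reward probabilities relative to 1/2 remain. -/
theorem historyMean_eq_density (t : ℕ) (f : BanditHistory S A L → ℝ) :
    historyMean w alg arrival t f =
      historyMean fairWeight alg arrival t (fun h => f h * density w h) := by
  induction t generalizing f with
  | zero => simp [historyMean, density]
  | succ t ih =>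
    simp only [historyMean]
    rw [ih]
    congr 1
    funext h
    simp only [stepMean, fairWeight, density, Finset.mul_sum, Finset.sum_mul]
    refine Finset.sum_congr rfl fun s _ => Finset.sum_congr rfl fun a _ =>
      Finset.sum_congr rfl fun r _ => by ring

/-- **Ville's inequality** for a nonnegative supermartingale under fair rewards. -/
theorem historyMean_exists_suffix_le [NeZero S] (Z : BanditHistory S A L → ℝ)
    (hZ0 : ∀ h, 0 ≤ Z h) (hZ1 : Z [] ≤ 1)
    (hZ : ∀ i h, stepMean fairWeight alg i Z h ≤ Z h) {c : ℝ} (hc : 0 < c) (t : ℕ) :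
    historyMean fairWeight alg arrival t
      (Set.indicator {h | ∃ h', h' <:+ h ∧ c ≤ Z h'} 1) ≤ 1 / c := by
  classical
  -- Freeze the process at the value `c` once it has reached `c`. The frozen process is still a
  -- supermartingale, and Markov's inequality at time `t` then covers all earlier times: suffixes of
  -- a history are its past.
  set F : BanditHistory S A L → ℝ := fun h => if ∃ h', h' <:+ h ∧ c ≤ Z h' then c else Z h
    with hF
  have hFle : ∀ x h, (¬ ∃ h', h' <:+ h ∧ c ≤ Z h') → F (x :: h) ≤ Z (x :: h) := by
    intro x h hh
    simp only [hF]
    split_ifs with hx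
    · obtain ⟨h', hs, hle⟩ := hx
      rcases List.suffix_cons_iff.mp hs with rfl | hs
      · exact hle
      · exact absurd ⟨h', hs, hle⟩ hh
    · exact le_rfl
  have hstep : ∀ i h, stepMean fairWeight alg i F h ≤ F h := by
    intro i h
    by_cases hh : ∃ h', h' <:+ h ∧ c ≤ Z h'
    · have hFh : F h = c := if_pos hh
      rw [hFh]
      refine (stepMean_mono (g := fun _ => c) fairWeight_nonneg fun s a r => ?_).trans
        (stepMean_const sum_fairWeight i c h).le
      obtain ⟨h', hs, hle⟩ := hh
      exact (if_pos ⟨h', List.suffix_cons_iff.mpr (Or.inr hs), hle⟩ : F _ = c).le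
    · have hFh : F h = Z h := if_neg hh
      rw [hFh]
      exact (stepMean_mono fairWeight_nonneg fun s a r => hFle _ h hh).trans (hZ i h)
  have hmean : ∀ t, historyMean fairWeight alg arrival t F ≤ F [] := by
    intro t
    induction t with
    | zero => exact le_rfl
    | succ t ih => exact (historyMean_mono fairWeight_nonneg t (hstep _)).trans ih
  have hF1 : F [] ≤ 1 := by
    simp only [hF]
    split_ifs with hx
    · obtain ⟨h', hs, hle⟩ := hx
      rw [List.suffix_nil.mp hs] at hle
      exact hle.trans hZ1
    · exact hZ1
  calc _ ≤ historyMean fairWeight alg arrival t (fun h => 1 / c * F h) := by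
        refine historyMean_mono fairWeight_nonneg t fun h => ?_
        by_cases hh : ∃ h', h' <:+ h ∧ c ≤ Z h'
        · rw [Set.indicator_of_mem (show h ∈ {h | ∃ h', h' <:+ h ∧ c ≤ Z h'} from hh),
            show F h = c from if_pos hh]
          simp [hc.ne']
        · rw [Set.indicator_of_notMem (show h ∉ {h | ∃ h', h' <:+ h ∧ c ≤ Z h'} from hh),
            show F h = Z h from if_neg hh]
          have := hZ0 h
          positivity
    _ = 1 / c * historyMean fairWeight alg arrival t F := historyMean_const_mul _ _ _
    _ ≤ 1 / c * 1 := by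
        gcongr
        exact (hmean t).trans hF1
    _ = 1 / c := mul_one _

/-- For uniform contexts, means under the law of the history are given by `historyMean`. -/
theorem MultiUserSystem.tsum_historyLaw (M : MultiUserSystem S A L)
    (hM : ∀ h i s, M.contextStep h i s = (S : ℝ≥0∞)⁻¹) [NeZero S]
    (hw : ∀ h i s a r, w h i s a r = (M.rewardStep h i s a r).toReal) (t : ℕ)
    (f : BanditHistory S A L → ℝ) (hf : ∀ h, 0 ≤ f h) :
    ∑' h, M.historyLaw alg arrival t h * ENNReal.ofReal (f h) =
      ENNReal.ofReal (historyMean w alg arrival t f) := by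
  have hw0 : ∀ h i s a r, 0 ≤ w h i s a r := fun h i s a r => by
    rw [hw]; exact ENNReal.toReal_nonneg
  induction t generalizing f with
  | zero => simp [MultiUserSystem.historyLaw, historyMean]
  | succ t ih =>
    have hstep : ∀ h, ENNReal.ofReal (stepMean w alg (arrival t) f h) =
        ∑ s, M.contextStep h (arrival t) s * ∑ a, alg.act h (arrival t) s a *
          ∑ r, M.rewardStep h (arrival t) s a r *
            ENNReal.ofReal (f (⟨arrival t, s, a, r⟩ :: h)) := by
      intro h
      have hS : (0 : ℝ) < S := Nat.cast_pos.mpr (Nat.pos_of_ne_zero (NeZero.ne S))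
      have hr : ∀ s a, 0 ≤ ∑ r, w h (arrival t) s a r * f (⟨arrival t, s, a, r⟩ :: h) :=
        fun s a => Finset.sum_nonneg fun r _ => mul_nonneg (hw0 _ _ _ _ _) (hf _)
      simp only [hM, ← Finset.mul_sum]
      rw [stepMean, ENNReal.ofReal_mul (by positivity), ENNReal.ofReal_inv_of_pos hS,
        ENNReal.ofReal_natCast, ENNReal.ofReal_sum_of_nonneg fun s _ =>
          Finset.sum_nonneg fun a _ => mul_nonneg ENNReal.toReal_nonneg (hr s a)]
      congr 1
      refine Finset.sum_congr rfl fun s _ => ?_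
      rw [ENNReal.ofReal_sum_of_nonneg fun a _ => mul_nonneg ENNReal.toReal_nonneg (hr s a)]
      refine Finset.sum_congr rfl fun a _ => ?_
      rw [ENNReal.ofReal_mul ENNReal.toReal_nonneg, ENNReal.ofReal_toReal (PMF.apply_ne_top _ _),
        ENNReal.ofReal_sum_of_nonneg fun r _ => mul_nonneg (hw0 _ _ _ _ _) (hf _)]
      congr 1
      refine Finset.sum_congr rfl fun r _ => ?_
      rw [ENNReal.ofReal_mul (hw0 _ _ _ _ _), hw, ENNReal.ofReal_toReal (PMF.apply_ne_top _ _)]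
    rw [historyMean, ← ih]
    · simp only [MultiUserSystem.historyLaw]
      rw [PMF.tsum_bind_mul]
      refine tsum_congr fun h => ?_
      rw [hstep]
      simp only [PMF.tsum_bind_mul, PMF.tsum_pure_mul, tsum_fintype]
    · intro h
      refine mul_nonneg (by positivity) (Finset.sum_nonneg fun s _ => Finset.sum_nonneg fun a _ =>
        mul_nonneg ENNReal.toReal_nonneg (Finset.sum_nonneg fun r _ =>
          mul_nonneg (hw0 _ _ _ _ _) (hf _)))

end Expect

/-! ### Hits of a random planted action: rarity, and the walk of their rewards. -/

section Hits

variable {S A L : ℕ}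
variable {w : BanditHistory S A L → Fin L → Fin S → Fin A → Bool → ℝ}
  {alg : BanditAlgorithm S A L} {arrival : ℕ → Fin L}

theorem indicator_one_le {Ω : Type*} {E : Set Ω} {ω : Ω} {c : ℝ} (hc : 0 ≤ c)
    (h : ω ∈ E → 1 ≤ c) : Set.indicator E (1 : Ω → ℝ) ω ≤ c := by
  by_cases hω : ω ∈ E
  · rw [Set.indicator_of_mem hω]
    exact h hω
  · rwa [Set.indicator_of_notMem hω]

theorem stepMean_le [NeZero S] {i : Fin L} {f : BanditHistory S A L → ℝ}
    {h : BanditHistory S A L} {c : ℝ}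
    (hf : ∀ s a, ∑ r, w h i s a r * f (⟨i, s, a, r⟩ :: h) ≤ c) : stepMean w alg i f h ≤ c := by
  have hS : (S : ℝ) ≠ 0 := Nat.cast_ne_zero.mpr (NeZero.ne S)
  calc stepMean w alg i f h
      ≤ (S : ℝ)⁻¹ * ∑ s, ∑ a, (alg.act h i s a).toReal * c := by
        unfold stepMean
        gcongr with s _ a _
        exact hf s a
    _ = c := by
        simp only [← Finset.sum_mul, PMF.sum_toReal, one_mul, Finset.sum_const,
          Finset.card_univ, Fintype.card_fin, nsmul_eq_mul]
        field_simp

/-- The algorithm has no influence on contexts. Hence visit counts have an explicit law, while hit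
counts can only be dominated. -/
theorem stepMean_of_context (hw : ∀ h i s a, ∑ r, w h i s a r = 1) {i : Fin L}
    {f : BanditHistory S A L → ℝ} {h : BanditHistory S A L} {g : Fin S → ℝ}
    (hf : ∀ s a r, f (⟨i, s, a, r⟩ :: h) = g s) :
    stepMean w alg i f h = (S : ℝ)⁻¹ * ∑ s, g s := by
  simp only [stepMean, hf, ← Finset.sum_mul, hw, PMF.sum_toReal, one_mul]

/-- Number of interactions in which user `i` was given the action `v s` in its context `s`. -/
def hitCount (i : Fin L) (v : Fin S → Fin A) (h : BanditHistory S A L) : ℕ :=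
  h.countP fun x => x.user = i ∧ x.action = v x.context

/-- Number of interactions in which user `i` was given action `a` in context `s`. -/
def useCount (i : Fin L) (s : Fin S) (a : Fin A) (h : BanditHistory S A L) : ℕ :=
  h.countP fun x => x.user = i ∧ x.context = s ∧ x.action = a

/-- Number of interactions in which user `i` revealed a context in `J`. -/
def visitCount (i : Fin L) (J : Finset (Fin S)) (h : BanditHistory S A L) : ℕ :=
  h.countP fun x => x.user = i ∧ x.context ∈ J

/-- Number of rewards `1` minus number of rewards `0` in the interactions counted by
`hitCount`. -/
def score (i : Fin L) (v : Fin S → Fin A) : BanditHistory S A L → ℝ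
  | [] => 0
  | x :: h => score i v h +
      if x.user = i ∧ x.action = v x.context then (if x.reward then 1 else -1) else 0

theorem hitCount_eq_sum_useCount (i : Fin L) (v : Fin S → Fin A) (h : BanditHistory S A L) :
    hitCount i v h = ∑ s, useCount i s (v s) h := by
  induction h with
  | nil => simp [hitCount, useCount]
  | cons x h ih =>
    have : (∑ s, if x.user = i ∧ x.context = s ∧ x.action = v s then 1 else 0) =
        if x.user = i ∧ x.action = v x.context then 1 else 0 := by
      rw [Finset.sum_eq_single x.context]
      · simp
      · intro b _ hb
        simp [hb.symm]
      · simp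
    simp only [hitCount, useCount, List.countP_cons, Finset.sum_add_distrib,
      decide_eq_true_eq] at ih ⊢
    rw [ih, this]

theorem sum_useCount (i : Fin L) (s : Fin S) (h : BanditHistory S A L) :
    ∑ a, useCount i s a h = visitCount i {s} h := by
  induction h with
  | nil => simp [useCount, visitCount]
  | cons x h ih =>
    have : (∑ a, if x.user = i ∧ x.context = s ∧ x.action = a then 1 else 0) =
        if x.user = i ∧ x.context ∈ ({s} : Finset (Fin S)) then 1 else 0 := by
      by_cases h1 : x.user = i ∧ x.context = s
      · simp [h1.1, h1.2]
      · rw [if_neg (by simpa using h1)]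
        refine Finset.sum_eq_zero fun a _ => if_neg fun h2 => h1 ⟨h2.1, h2.2.1⟩
    simp only [useCount, visitCount, List.countP_cons, Finset.sum_add_distrib,
      decide_eq_true_eq] at ih ⊢
    rw [ih, this]

theorem sum_visitCount (i : Fin L) (J : Finset (Fin S)) (h : BanditHistory S A L) :
    ∑ s ∈ J, visitCount i {s} h = visitCount i J h := by
  induction h with
  | nil => simp [visitCount]
  | cons x h ih =>
    have : (∑ s ∈ J, if x.user = i ∧ x.context ∈ ({s} : Finset (Fin S)) then 1 else 0) =
        if x.user = i ∧ x.context ∈ J then 1 else 0 := by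
      by_cases h1 : x.user = i
      · simp [h1]
      · simp [h1]
    simp only [visitCount, List.countP_cons, Finset.sum_add_distrib,
      decide_eq_true_eq] at ih ⊢
    rw [ih, this]

theorem hitCount_le_of_suffix (i : Fin L) (v : Fin S → Fin A) {h h' : BanditHistory S A L}
    (hs : h' <:+ h) : hitCount i v h' ≤ hitCount i v h :=
  hs.sublist.countP_le

theorem score_le_hitCount (i : Fin L) (v : Fin S → Fin A) (h : BanditHistory S A L) :
    score i v h ≤ hitCount i v h := by
  induction h with
  | nil => simp [score, hitCount]
  | cons x h ih =>
    simp only [score, hitCount, List.countP_cons, decide_eq_true_eq, Nat.cast_add,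
      Nat.cast_ite, Nat.cast_one, Nat.cast_zero] at ih ⊢
    split_ifs <;> linarith

theorem numInteractions_succ (arrival : ℕ → Fin L) (t : ℕ) (i : Fin L) :
    numInteractions arrival (t + 1) i =
      numInteractions arrival t i + if arrival t = i then 1 else 0 := by
  unfold numInteractions
  rw [Finset.range_add_one, Finset.filter_insert]
  split_ifs <;> simp

/-- The probability generating function of the number of visits of a set of contexts. -/
theorem historyMean_pow_visitCount [NeZero S] (i : Fin L) (J : Finset (Fin S)) (y : ℝ) (t : ℕ) :
    historyMean fairWeight alg arrival t (fun h => y ^ visitCount i J h) =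
      (1 + (y - 1) * (J.card / S)) ^ numInteractions arrival t i := by
  have hS : (S : ℝ) ≠ 0 := Nat.cast_ne_zero.mpr (NeZero.ne S)
  induction t with
  | zero => simp [historyMean, visitCount, numInteractions]
  | succ t ih =>
    have hstep : stepMean fairWeight alg (arrival t) (fun h => y ^ visitCount i J h) =
        fun h => (if arrival t = i then 1 + (y - 1) * (J.card / S) else 1) *
          y ^ visitCount i J h := by
      funext h
      rw [stepMean_of_context (g := fun s => (1 + if arrival t = i ∧ s ∈ J then y - 1 else 0) *
        y ^ visitCount i J h) sum_fairWeight]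
      · rw [← Finset.sum_mul, ← mul_assoc]
        congr 1
        split_ifs with hi
        · simp only [hi, true_and, Finset.sum_add_distrib, Finset.sum_const, Finset.card_univ,
            Fintype.card_fin, nsmul_eq_mul, ← Finset.sum_filter, Finset.filter_univ_mem]
          field_simp
        · simp [hi, hS]
      · intro s a r
        simp only [visitCount, List.countP_cons, decide_eq_true_eq, pow_add]
        split_ifs <;> ring
    rw [historyMean, hstep, historyMean_const_mul, ih, numInteractions_succ]
    split_ifs
    · rw [pow_succ]; ring
    · simp

/-- The function n ↦ yⁿ − 1 is superadditive. So for the exponential moment of hits, always playing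
one action in a context is at least as good as spreading its visits over several. -/
theorem sum_pow_le_pow_sum {ι : Type*} (J : Finset ι) (n : ι → ℕ) {y : ℝ} (hy : 1 ≤ y) :
    ∑ a ∈ J, (y ^ n a - 1) ≤ y ^ (∑ a ∈ J, n a) - 1 := by
  classical
  induction J using Finset.induction_on with
  | empty => simp
  | insert j J hj ih =>
    rw [Finset.sum_insert hj, Finset.sum_insert hj, pow_add]
    have h1 : 1 ≤ y ^ n j := one_le_pow₀ hy
    have h2 : 1 ≤ y ^ (∑ a ∈ J, n a) := one_le_pow₀ hy
    nlinarith [mul_nonneg (sub_nonneg.mpr h1) (sub_nonneg.mpr h2)]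

theorem sum_ite_eq_add_card [NeZero A] (a₀ : Fin A) (u : ℝ) :
    ∑ a : Fin A, (if a = a₀ then u else 1) = A + (u - 1) := by
  have : ∀ a : Fin A, (if a = a₀ then u else 1) = 1 + if a = a₀ then u - 1 else 0 := by
    intro a; split_ifs <;> ring
  simp only [this, Finset.sum_add_distrib]
  simp

/-- For a uniformly random `v`, the number of hits is dominated by the number of visits of a random
set of contexts. -/
theorem sum_pow_hitCount_le [NeZero A] (i : Fin L) (h : BanditHistory S A L) {y : ℝ}
    (hy : 1 ≤ y) :
    ∑ v : Fin S → Fin A, y ^ hitCount i v h ≤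
      ∑ v : Fin S → Fin A, y ^ visitCount i (Finset.univ.filter fun s => v s = 0) h := by
  calc ∑ v : Fin S → Fin A, y ^ hitCount i v h
      = ∏ s : Fin S, ∑ a : Fin A, y ^ useCount i s a h := by
        rw [Fintype.prod_sum]
        simp only [hitCount_eq_sum_useCount, Finset.prod_pow_eq_pow_sum]
    _ ≤ ∏ s : Fin S, ∑ a : Fin A, if a = 0 then y ^ visitCount i {s} h else 1 := by
        refine Finset.prod_le_prod (fun s _ => Finset.sum_nonneg fun a _ => by positivity)
          fun s _ => ?_
        rw [sum_ite_eq_add_card, ← sum_useCount]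
        have := sum_pow_le_pow_sum Finset.univ (fun a => useCount i s a h) hy
        simp only [Finset.sum_sub_distrib, Finset.sum_const, Finset.card_univ, Fintype.card_fin,
          nsmul_eq_mul, mul_one] at this
        linarith
    _ = _ := by
        rw [Fintype.prod_sum]
        refine Finset.sum_congr rfl fun v _ => ?_
        rw [← sum_visitCount, ← Finset.prod_pow_eq_pow_sum, Finset.prod_filter]

/-- Exponential moment of the number of hits of a uniformly random `v` under fair rewards. -/
theorem sum_historyMean_pow_hitCount_le [NeZero S] [NeZero A] (i : Fin L) {y : ℝ} (hy : 1 ≤ y)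
    (t : ℕ) (hNS : numInteractions arrival t i * (y - 1) ≤ S)
    (hNA : numInteractions arrival t i * (y - 1) ≤ A) :
    ∑ v : Fin S → Fin A, historyMean fairWeight alg arrival t (fun h => y ^ hitCount i v h) ≤
      (A : ℝ) ^ S * Real.exp 2 := by
  have hS : (0 : ℝ) < S := Nat.cast_pos.mpr (Nat.pos_of_ne_zero (NeZero.ne S))
  have hA : (0 : ℝ) < A := Nat.cast_pos.mpr (Nat.pos_of_ne_zero (NeZero.ne A))
  set N : ℕ := numInteractions arrival t i with hN
  set κ : ℝ := N * (y - 1) / S with hκ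
  have hκ0 : 0 ≤ κ := by
    have : 0 ≤ y - 1 := by linarith
    positivity
  -- The bound by `S` linearizes exp κ here; the bound by `A` controls the final exponent S · 2κ / A
  -- = 2N(y − 1)/A.
  have hκ1 : κ ≤ 1 := (div_le_one hS).mpr hNS
  have hexp : Real.exp κ - 1 ≤ 2 * κ := by
    have := Real.abs_exp_sub_one_le (x := κ) (by rwa [abs_of_nonneg hκ0])
    rw [abs_of_nonneg hκ0] at this
    exact (le_abs_self _).trans this
  calc ∑ v : Fin S → Fin A, historyMean fairWeight alg arrival t (fun h => y ^ hitCount i v h)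
      = historyMean fairWeight alg arrival t
          (fun h => ∑ v : Fin S → Fin A, y ^ hitCount i v h) := (historyMean_sum _ _ _).symm
    _ ≤ historyMean fairWeight alg arrival t (fun h => ∑ v : Fin S → Fin A,
          y ^ visitCount i (Finset.univ.filter fun s => v s = 0) h) :=
        historyMean_mono fairWeight_nonneg t fun h => sum_pow_hitCount_le i h hy
    _ = ∑ v : Fin S → Fin A, (1 + (y - 1) *
          ((Finset.univ.filter fun s => v s = 0).card / S)) ^ N := by
        rw [historyMean_sum]
        simp only [historyMean_pow_visitCount, hN]
    _ ≤ ∑ v : Fin S → Fin A, ∏ s, (if v s = 0 then Real.exp κ else 1) := by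
        refine Finset.sum_le_sum fun v _ => ?_
        rw [← Finset.prod_filter, Finset.prod_const, ← Real.exp_nat_mul]
        set k : ℕ := (Finset.univ.filter fun s => v s = 0).card
        have h1 : 0 ≤ (y - 1) * (k / S : ℝ) :=
          mul_nonneg (by linarith) (by positivity)
        calc (1 + (y - 1) * (k / S : ℝ)) ^ N
            ≤ (Real.exp ((y - 1) * (k / S : ℝ))) ^ N := by
              refine pow_le_pow_left₀ (by linarith) ?_ N
              linarith [Real.add_one_le_exp ((y - 1) * (k / S : ℝ))]
          _ = Real.exp (k * κ) := by
              rw [← Real.exp_nat_mul, hκ]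
              congr 1
              ring
    _ = (A + (Real.exp κ - 1)) ^ S := by
        have := Fintype.prod_sum fun (_ : Fin S) (a : Fin A) => if a = 0 then Real.exp κ else 1
        rw [← this]
        simp only [sum_ite_eq_add_card, Finset.prod_const, Finset.card_univ, Fintype.card_fin]
    _ = (A : ℝ) ^ S * (1 + (Real.exp κ - 1) / A) ^ S := by
        rw [← mul_pow]
        congr 1
        field_simp
    _ ≤ (A : ℝ) ^ S * Real.exp 2 := by
        gcongr
        have h0 : 0 ≤ (Real.exp κ - 1) / A :=
          div_nonneg (by linarith [Real.add_one_le_exp κ]) hA.le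
        calc (1 + (Real.exp κ - 1) / A) ^ S
            ≤ (Real.exp ((Real.exp κ - 1) / A)) ^ S := by
              refine pow_le_pow_left₀ (by linarith) ?_ S
              linarith [Real.add_one_le_exp ((Real.exp κ - 1) / A)]
          _ = Real.exp (S * ((Real.exp κ - 1) / A)) := by rw [← Real.exp_nat_mul]
          _ ≤ Real.exp 2 := by
              refine Real.exp_le_exp.mpr ?_
              calc S * ((Real.exp κ - 1) / A) ≤ S * (2 * κ / A) := by gcongr
                _ = 2 * (N * (y - 1) / A) := by rw [hκ]; field_simp
                _ ≤ 2 * 1 := by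
                    gcongr
                    exact (div_le_one hA).mpr hNA
                _ = 2 := by norm_num

/-- Markov's inequality for the number of hits of a uniformly random `v`. -/
theorem sum_historyMean_le_hitCount [NeZero S] [NeZero A] (i : Fin L) {y K : ℝ} (hy : 1 ≤ y)
    (t : ℕ) (hNS : numInteractions arrival t i * (y - 1) ≤ S)
    (hNA : numInteractions arrival t i * (y - 1) ≤ A) :
    ∑ v : Fin S → Fin A, historyMean fairWeight alg arrival t
        (Set.indicator {h | K ≤ hitCount i v h} 1) ≤
      (A : ℝ) ^ S * Real.exp (2 - Real.log y * K) := by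
  have hy0 : 0 < y := by linarith
  calc _ ≤ ∑ v : Fin S → Fin A, historyMean fairWeight alg arrival t
        (fun h => Real.exp (-(Real.log y * K)) * y ^ hitCount i v h) := by
        refine Finset.sum_le_sum fun v _ => historyMean_mono fairWeight_nonneg t fun h => ?_
        refine indicator_one_le (by positivity) fun hh => ?_
        have hy' : y ^ hitCount i v h = Real.exp (hitCount i v h * Real.log y) := by
          rw [Real.exp_nat_mul, Real.exp_log hy0]
        rw [hy', ← Real.exp_add, Real.one_le_exp_iff]
        have := mul_le_mul_of_nonneg_left (show K ≤ hitCount i v h from hh)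
          (Real.log_nonneg hy)
        linarith
    _ ≤ Real.exp (-(Real.log y * K)) * ((A : ℝ) ^ S * Real.exp 2) := by
        simp only [historyMean_const_mul, ← Finset.mul_sum]
        gcongr
        exact sum_historyMean_pow_hitCount_le i hy t hNS hNA
    _ = _ := by
        rw [show 2 - Real.log y * K = -(Real.log y * K) + 2 by ring, Real.exp_add]
        ring

/-- Under fair rewards, a large score needs many hits or is unlikely. -/
theorem historyMean_exists_score_gt_le [NeZero S] (i : Fin L) (v : Fin S → Fin A) {x K : ℝ}
    (hx : 0 < x) (hK : 0 < K) (t : ℕ) :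
    historyMean fairWeight alg arrival t
        (Set.indicator {h | ∃ h', h' <:+ h ∧ x < score i v h'} 1) ≤
      historyMean fairWeight alg arrival t (Set.indicator {h | K ≤ hitCount i v h} 1) +
        Real.exp (-(x ^ 2 / (2 * K))) := by
  classical
  -- This slope maximizes l x − l² K / 2, with maximum x² / (2K). The process `Z` is a
  -- supermartingale because cosh l ≤ exp(l² / 2).
  set l : ℝ := x / K with hl
  set Z : BanditHistory S A L → ℝ :=
    fun h => Real.exp (l * score i v h - l ^ 2 / 2 * hitCount i v h) with hZ
  have hville := historyMean_exists_suffix_le (alg := alg) (arrival := arrival) Z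
    (fun h => (Real.exp_pos _).le) (by simp [hZ, score, hitCount]) (fun j h => by
      refine stepMean_le fun s a => ?_
      simp only [Fintype.sum_bool, fairWeight, hZ, score, hitCount, List.countP_cons,
        decide_eq_true_eq]
      by_cases hj : j = i ∧ a = v s
      · simp only [hj, and_self, if_true, Nat.cast_add, Nat.cast_one]
        have hcosh := Real.cosh_le_exp_half_sq l
        rw [Real.cosh_eq] at hcosh
        set u : ℝ := l * score i v h - l ^ 2 / 2 * hitCount i v h with hu
        have e1 : l * (score i v h + 1) - l ^ 2 / 2 * ((hitCount i v h : ℝ) + 1) =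
            u + l - l ^ 2 / 2 := by rw [hu]; ring
        have e2 : l * (score i v h + -1) - l ^ 2 / 2 * ((hitCount i v h : ℝ) + 1) =
            u + -l - l ^ 2 / 2 := by rw [hu]; ring
        simp only [hitCount, Bool.false_eq_true, if_false] at e1 e2 hu ⊢
        rw [e1, e2, ← hu]
        simp only [Real.exp_sub, Real.exp_add]
        have h1 := Real.exp_pos u
        have h2 := Real.exp_pos (l ^ 2 / 2)
        rw [show 1 / 2 * (Real.exp u * Real.exp l / Real.exp (l ^ 2 / 2)) +
          1 / 2 * (Real.exp u * Real.exp (-l) / Real.exp (l ^ 2 / 2)) =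
          Real.exp u * ((Real.exp l + Real.exp (-l)) / 2 / Real.exp (l ^ 2 / 2)) by ring]
        exact mul_le_of_le_one_right h1.le ((div_le_one h2).mpr hcosh)
      · simp only [hj, if_false, add_zero]
        apply le_of_eq
        ring) (Real.exp_pos (x ^ 2 / (2 * K))) t
  rw [one_div, ← Real.exp_neg] at hville
  refine le_trans ?_ (add_le_add_right hville _)
  rw [← historyMean_add]
  refine historyMean_mono fairWeight_nonneg t fun h => ?_
  have n1 : 0 ≤ Set.indicator {h | K ≤ hitCount i v h} (1 : BanditHistory S A L → ℝ) h :=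
    Set.indicator_nonneg (fun _ _ => zero_le_one) h
  have n2 : 0 ≤ Set.indicator {h | ∃ h', h' <:+ h ∧ Real.exp (x ^ 2 / (2 * K)) ≤ Z h'}
      (1 : BanditHistory S A L → ℝ) h :=
    Set.indicator_nonneg (fun _ _ => zero_le_one) h
  refine indicator_one_le (add_nonneg n1 n2) ?_
  rintro ⟨h', hs, hlt⟩
  by_cases hH : K ≤ hitCount i v h
  · rw [Set.indicator_of_mem (show h ∈ {h | K ≤ (hitCount i v h : ℝ)} from hH)]
    simpa using n2
  · have hmem : h ∈ {h | ∃ h', h' <:+ h ∧ Real.exp (x ^ 2 / (2 * K)) ≤ Z h'} := by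
      refine ⟨h', hs, Real.exp_le_exp.mpr ?_⟩
      have hle : (hitCount i v h' : ℝ) ≤ K :=
        (Nat.cast_le.mpr (hitCount_le_of_suffix i v hs)).trans (not_le.mp hH).le
      have hl0 : 0 < l := div_pos hx hK
      calc x ^ 2 / (2 * K) = l * x - l ^ 2 / 2 * K := by rw [hl]; field_simp; ring
        _ ≤ l * score i v h' - l ^ 2 / 2 * hitCount i v h' := by gcongr
    rw [Set.indicator_of_mem hmem]
    simpa using n1

/-- Under fair rewards, a large score needs at least as many hits. -/
theorem historyMean_exists_score_gt_le_hitCount (i : Fin L) (v : Fin S → Fin A) (x : ℝ) (t : ℕ) :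
    historyMean fairWeight alg arrival t
        (Set.indicator {h | ∃ h', h' <:+ h ∧ x < score i v h'} 1) ≤
      historyMean fairWeight alg arrival t (Set.indicator {h | x ≤ hitCount i v h} 1) := by
  refine historyMean_mono fairWeight_nonneg t fun h => ?_
  refine Set.indicator_le_indicator_of_subset ?_ (fun _ => zero_le_one) h
  rintro h ⟨h', hs, hlt⟩
  exact hlt.le.trans ((score_le_hitCount i v h').trans
    (Nat.cast_le.mpr (hitCount_le_of_suffix i v hs)))

end Hits

/-! ### Planted bandits whose bad users hide the planted rewards. -/

section HardSystem

/-- The Bernoulli law on `Bool` with success probability `q` (clipped to `[0,1]`). -/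
noncomputable def coin (q : ℝ) : PMF Bool :=
  PMF.ofFintype (fun r => if r then min (ENNReal.ofReal q) 1 else 1 - min (ENNReal.ofReal q) 1)
    (by simp)

theorem coin_toReal {q : ℝ} (h0 : 0 ≤ q) (h1 : q ≤ 1) (r : Bool) :
    (coin q r).toReal = if r then q else 1 - q := by
  have h2 : min (ENNReal.ofReal q) 1 = ENNReal.ofReal q :=
    min_eq_left (ENNReal.ofReal_le_one.mpr h1)
  cases r
  · simp only [coin, PMF.ofFintype_apply, h2, Bool.false_eq_true, if_false]
    rw [ENNReal.toReal_sub_of_le (ENNReal.ofReal_le_one.mpr h1) ENNReal.one_ne_top,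
      ENNReal.toReal_one, ENNReal.toReal_ofReal h0]
  · simp [coin, h2, h0]

variable {S A L : ℕ}

/-- The bandit with uniform contexts in which action `v s` has mean reward `(1 + δ) / 2` in context
`s`, and all other actions have mean reward `1 / 2`. -/
noncomputable def plantedBandit [NeZero S] (v : Fin S → Fin A) (δ : ℝ) : BernoulliBandit S A where
  contextLaw := PMF.uniformOfFintype (Fin S)
  rewardLaw s a := if a = v s then coin ((1 + δ) / 2) else coin (1 / 2)

/-- The likelihood ratio, between planted and fair rewards, of the interactions with user `i`. -/
noncomputable def plantedRatio (v : Fin S → Fin A) (δ : ℝ) (i : Fin L) :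
    BanditHistory S A L → ℝ
  | [] => 1
  | x :: h => plantedRatio v δ i h * if x.user = i ∧ x.action = v x.context then
      (if x.reward then 1 + δ else 1 - δ) else 1

/-- The reward law by which a bad user hides the planted rewards of a good user, if users are bad
with probability `p`: as long as possible, the mixture of the two is a fair coin. -/
noncomputable def hidingReward (v : Fin S → Fin A) (δ p : ℝ) (h : BanditHistory S A L) (i : Fin L)
    (s : Fin S) (a : Fin A) : PMF Bool :=
  if a = v s ∧ (1 - p) * plantedRatio v δ i h * (1 + δ) ≤ 1 then
    coin ((1 - (1 - p) * plantedRatio v δ i h * (1 + δ)) /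
      (2 * (1 - (1 - p) * plantedRatio v δ i h)))
  else coin (1 / 2)

/-- The planted bandit with good users `G` and hiding bad users. -/
noncomputable def hidingSystem [NeZero S] (v : Fin S → Fin A) (δ p : ℝ) (G : Finset (Fin L)) :
    MultiUserSystem S A L where
  good := G
  bandit := plantedBandit v δ
  advContext _ _ := PMF.uniformOfFintype (Fin S)
  advReward := hidingReward v δ p

/-- The likelihood ratio, between hiding and fair rewards, of the interactions with user `i`. -/
noncomputable def hidingRatio (v : Fin S → Fin A) (δ p : ℝ) (i : Fin L) :
    BanditHistory S A L → ℝ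
  | [] => 1
  | x :: h => hidingRatio v δ p i h * if x.user = i then
      2 * (hidingReward v δ p h i x.context x.action x.reward).toReal else 1

/-- The reward probabilities of `hidingSystem`. -/
noncomputable def hidingWeight [NeZero S] (v : Fin S → Fin A) (δ p : ℝ) (G : Finset (Fin L)) :
    BanditHistory S A L → Fin L → Fin S → Fin A → Bool → ℝ :=
  fun h i s a r => ((hidingSystem v δ p G).rewardStep h i s a r).toReal

/-- The probability that the set of good users is `G`, if users are independently bad with
probability `p`. -/
noncomputable def goodPrior (p : ℝ) (G : Finset (Fin L)) : ℝ :=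
  ∏ i, if i ∈ G then 1 - p else p

/-- Throughout the history, user `i` can be a hiding bad user. -/
def Hideable (v : Fin S → Fin A) (δ p : ℝ) (i : Fin L) (h : BanditHistory S A L) : Prop :=
  ∀ h', h' <:+ h → (1 - p) * plantedRatio v δ i h' * (1 + δ) ≤ 1

theorem plantedRatio_nonneg (v : Fin S → Fin A) {δ : ℝ} (h0 : 0 < δ) (h1 : δ ≤ 1) (i : Fin L)
    (h : BanditHistory S A L) : 0 ≤ plantedRatio v δ i h := by
  induction h with
  | nil => exact zero_le_one
  | cons x h ih =>
    refine mul_nonneg ih ?_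
    split_ifs <;> linarith

theorem hidingRatio_nonneg (v : Fin S → Fin A) (δ p : ℝ) (i : Fin L)
    (h : BanditHistory S A L) : 0 ≤ hidingRatio v δ p i h := by
  induction h with
  | nil => exact zero_le_one
  | cons x h ih =>
    refine mul_nonneg ih ?_
    split_ifs
    · positivity
    · exact zero_le_one

theorem plantedBandit_rewardLaw_toReal [NeZero S] (v : Fin S → Fin A) {δ : ℝ} (h0 : 0 < δ)
    (h1 : δ ≤ 1) (s : Fin S) (a : Fin A) (r : Bool) :
    ((plantedBandit v δ).rewardLaw s a r).toReal =
      if a = v s then (if r then (1 + δ) / 2 else (1 - δ) / 2) else 1 / 2 := by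
  simp only [plantedBandit]
  split_ifs with ha hr
  · rw [coin_toReal (by linarith) (by linarith), if_pos hr]
  · rw [coin_toReal (by linarith) (by linarith), if_neg hr]
    ring
  · rw [coin_toReal (by norm_num) (by norm_num)]
    split_ifs <;> norm_num

/-- The factorization over users holds because a hiding user reacts to its own past only, although
an adversary could coordinate all bad users. -/
theorem density_hidingWeight [NeZero S] (v : Fin S → Fin A) {δ : ℝ} (h0 : 0 < δ) (h1 : δ ≤ 1)
    (p : ℝ) (G : Finset (Fin L)) (h : BanditHistory S A L) :
    density (hidingWeight v δ p G) h =
      ∏ i, if i ∈ G then plantedRatio v δ i h else hidingRatio v δ p i h := by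
  induction h with
  | nil => simp [density, plantedRatio, hidingRatio]
  | cons x h ih =>
    have hx : ∀ i, (if i ∈ G then plantedRatio v δ i (x :: h) else hidingRatio v δ p i (x :: h)) =
        (if i ∈ G then plantedRatio v δ i h else hidingRatio v δ p i h) *
        (if i = x.user then 2 * hidingWeight v δ p G h x.user x.context x.action x.reward
          else 1) := by
      intro i
      by_cases hi : i = x.user
      · subst hi
        by_cases hG : x.user ∈ G
        · simp only [hG, if_true, plantedRatio, hidingWeight, MultiUserSystem.rewardStep,
            hidingSystem, plantedBandit_rewardLaw_toReal v h0 h1, true_and]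
          congr 1
          split_ifs <;> ring
        · simp only [hG, if_false, if_true, hidingRatio, hidingWeight, MultiUserSystem.rewardStep,
            hidingSystem]
      · have hi' : x.user ≠ i := fun h => hi h.symm
        simp [plantedRatio, hidingRatio, hi, hi']
    simp only [density, hx, Finset.prod_mul_distrib, ih]
    simp

/-- With u = (1 − p) · `plantedRatio`, the posterior weights of good and bad are u and 1 − u. The
bad user's probability q of reward 1 solves u(1 + δ) + (1 − u) · 2q = 1; the equation for reward 0
follows. Hideability is what makes q nonnegative. -/
theorem mixture_eq_one (v : Fin S → Fin A) {δ p : ℝ} (h0 : 0 < δ) (h1 : δ ≤ 1) (hp : p < 1)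
    (i : Fin L) (h : BanditHistory S A L) (hs : Hideable v δ p i h) :
    (1 - p) * plantedRatio v δ i h + p * hidingRatio v δ p i h = 1 := by
  induction h with
  | nil => simp [plantedRatio, hidingRatio]
  | cons x h ih =>
    have hsafe := hs h (List.suffix_cons x h)
    have ih := ih fun h' hh' => hs h' (hh'.trans (List.suffix_cons x h))
    simp only [plantedRatio, hidingRatio, hidingReward, hsafe, and_true]
    set u : ℝ := (1 - p) * plantedRatio v δ i h with hu
    have hu0 : 0 ≤ u := mul_nonneg (by linarith) (plantedRatio_nonneg v h0 h1 i h)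
    have hu1 : u < 1 := by
      by_contra hcon
      nlinarith [mul_le_mul_of_nonneg_right (not_lt.mp hcon) h0.le]
    by_cases hi : x.user = i
    · by_cases ha : x.action = v x.context
      · have hq0 : 0 ≤ (1 - u * (1 + δ)) / (2 * (1 - u)) :=
          div_nonneg (by linarith) (by linarith)
        have hq1 : (1 - u * (1 + δ)) / (2 * (1 - u)) ≤ 1 := by
          rw [div_le_one (by linarith)]
          nlinarith [mul_nonneg hu0 h0.le]
        have hne : 1 - u ≠ 0 := by linarith
        have hpr : p * hidingRatio v δ p i h = 1 - u := by linarith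
        simp only [hi, ha, and_self, if_true, coin_toReal hq0 hq1]
        rw [← mul_assoc, ← mul_assoc, ← hu, hpr]
        split_ifs <;> field_simp <;> ring
      · simp only [hi, ha, and_false, if_false, if_true, mul_one,
          coin_toReal (show (0 : ℝ) ≤ 1 / 2 by norm_num) (by norm_num)]
        split_ifs <;> linarith
    · simp only [hi, false_and, if_false, mul_one]
      exact ih

/-- This is the independence of the users: expanding a product of sums gives one term for each set
of good users. -/
theorem sum_prod_ite_mem {ι : Type*} [Fintype ι] [DecidableEq ι] (f g : ι → ℝ) :
    ∑ G : Finset ι, ∏ i, (if i ∈ G then f i else g i) = ∏ i, (f i + g i) := by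
  rw [Finset.prod_add, Finset.powerset_univ]
  refine Finset.sum_congr rfl fun G _ => ?_
  rw [Finset.prod_ite]
  congr 1
  · simp
  · exact Finset.prod_congr (by ext; simp) fun _ _ => rfl

theorem sum_goodPrior (p : ℝ) : ∑ G : Finset (Fin L), goodPrior p G = 1 := by
  unfold goodPrior
  rw [sum_prod_ite_mem]
  simp

theorem goodPrior_nonneg {p : ℝ} (h0 : 0 ≤ p) (h1 : p ≤ 1) (G : Finset (Fin L)) :
    0 ≤ goodPrior p G :=
  Finset.prod_nonneg fun i _ => by split_ifs <;> linarith

/-- The expected number of bad users. -/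
theorem sum_goodPrior_mul_card (p : ℝ) :
    ∑ G : Finset (Fin L), goodPrior p G * ((L : ℝ) - G.card) = p * L := by
  have hcard : ∀ G : Finset (Fin L), (L : ℝ) - G.card = ∑ j : Fin L, if j ∈ G then 0 else 1 := by
    intro G
    have : ∀ j : Fin L, (if j ∈ G then (0 : ℝ) else 1) = 1 - if j ∈ G then 1 else 0 := by
      intro j; split_ifs <;> simp
    simp [this]
  have hj : ∀ j : Fin L, ∑ G : Finset (Fin L), goodPrior p G * (if j ∈ G then 0 else 1) = p := by
    intro j
    have : ∀ G : Finset (Fin L), goodPrior p G * (if j ∈ G then 0 else 1) =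
        ∏ i, if i ∈ G then (if i = j then 0 else 1 - p) else p := by
      intro G
      unfold goodPrior
      split_ifs with hG
      · rw [mul_zero]
        exact (Finset.prod_eq_zero (Finset.mem_univ j) (by simp [hG])).symm
      · rw [mul_one]
        refine Finset.prod_congr rfl fun i _ => ?_
        by_cases hij : i = j
        · subst hij; simp [hG]
        · simp [hij]
    simp only [this, sum_prod_ite_mem]
    rw [Finset.prod_eq_single j]
    · simp
    · intro i _ hij; simp [hij]
    · simp
  simp only [hcard, Finset.mul_sum]
  rw [Finset.sum_comm]
  simp only [hj, Finset.sum_const, Finset.card_univ, Fintype.card_fin, nsmul_eq_mul]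
  exact mul_comm _ _

/-- With probability at least `1 / 2`, at most twice the expected number of users is bad. -/
theorem half_le_sum_goodPrior {α : ℝ} (h0 : 0 < α) (h1 : α ≤ 1) (hL : 0 < L) :
    1 / 2 ≤ ∑ G : Finset (Fin L) with (1 - α) * (L : ℝ) ≤ G.card, goodPrior (α / 2) G := by
  have hpr := fun G : Finset (Fin L) =>
    goodPrior_nonneg (show 0 ≤ α / 2 by linarith) (by linarith) G
  have hL' : (0 : ℝ) < L := Nat.cast_pos.mpr hL
  have htot := sum_goodPrior (L := L) (α / 2)
  rw [← Finset.sum_filter_add_sum_filter_not Finset.univ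
    (fun G : Finset (Fin L) => (1 - α) * (L : ℝ) ≤ G.card)] at htot
  -- Markov's inequality: the excluded sets have more than αL bad users, while the mean number is
  -- αL/2.
  have hbad : (α * L) * ∑ G : Finset (Fin L) with ¬ (1 - α) * (L : ℝ) ≤ G.card,
      goodPrior (α / 2) G ≤ α / 2 * L := by
    rw [← sum_goodPrior_mul_card (α / 2), Finset.mul_sum]
    calc _ ≤ ∑ G : Finset (Fin L) with ¬ (1 - α) * (L : ℝ) ≤ G.card,
          goodPrior (α / 2) G * ((L : ℝ) - G.card) := by
          refine Finset.sum_le_sum fun G hG => ?_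
          have := (Finset.mem_filter.mp hG).2
          rw [mul_comm]
          exact mul_le_mul_of_nonneg_left (by linarith) (hpr G)
      _ ≤ _ := by
          refine Finset.sum_le_sum_of_subset_of_nonneg (Finset.filter_subset _ _) fun G _ _ => ?_
          refine mul_nonneg (hpr G) (sub_nonneg.mpr ?_)
          have := Finset.card_le_univ G
          rw [Fintype.card_fin] at this
          exact_mod_cast this
  have : (α * L) * ∑ G : Finset (Fin L) with ¬ (1 - α) * (L : ℝ) ≤ G.card,
      goodPrior (α / 2) G ≤ (α * L) * (1 / 2) := by linarith
  have := le_of_mul_le_mul_left this (by positivity)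
  linarith

theorem sum_hidingWeight [NeZero S] (v : Fin S → Fin A) (δ p : ℝ) (G : Finset (Fin L))
    (h : BanditHistory S A L) (i : Fin L) (s : Fin S) (a : Fin A) :
    ∑ r, hidingWeight v δ p G h i s a r = 1 :=
  PMF.sum_toReal _

/-- Averaged over the set of good users, the hiding system looks like fair rewards until some user
stops being hideable. -/
theorem sum_goodPrior_mul_historyMean_le [NeZero S] (v : Fin S → Fin A) {δ p : ℝ} (h0 : 0 < δ)
    (h1 : δ ≤ 1) (hp0 : 0 ≤ p) (hp1 : p < 1) (alg : BanditAlgorithm S A L) (arrival : ℕ → Fin L)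
    (t : ℕ) {f : BanditHistory S A L → ℝ} (hf0 : ∀ h, 0 ≤ f h) (hf1 : ∀ h, f h ≤ 1) :
    ∑ G : Finset (Fin L), goodPrior p G * historyMean (hidingWeight v δ p G) alg arrival t f ≤
      historyMean fairWeight alg arrival t f +
        ∑ i, historyMean fairWeight alg arrival t
          (Set.indicator {h | ¬ Hideable v δ p i h} 1) := by
  set m : BanditHistory S A L → ℝ :=
    fun h => ∑ G : Finset (Fin L), goodPrior p G * density (hidingWeight v δ p G) h with hm
  have hmprod : ∀ h, m h =
      ∏ i, ((1 - p) * plantedRatio v δ i h + p * hidingRatio v δ p i h) := by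
    intro h
    rw [← sum_prod_ite_mem]
    refine Finset.sum_congr rfl fun G _ => ?_
    rw [density_hidingWeight v h0 h1, goodPrior, ← Finset.prod_mul_distrib]
    refine Finset.prod_congr rfl fun i _ => ?_
    split_ifs <;> rfl
  have hm0 : ∀ h, 0 ≤ m h := fun h => by
    rw [hmprod]
    refine Finset.prod_nonneg fun i _ => add_nonneg
      (mul_nonneg (by linarith) (plantedRatio_nonneg v h0 h1 i h))
      (mul_nonneg hp0 (hidingRatio_nonneg v δ p i h))
  have hmix : ∀ f : BanditHistory S A L → ℝ,
      ∑ G : Finset (Fin L), goodPrior p G * historyMean (hidingWeight v δ p G) alg arrival t f =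
      historyMean fairWeight alg arrival t (fun h => f h * m h) := by
    intro f
    simp only [historyMean_eq_density (w := hidingWeight v δ p _), ← historyMean_const_mul,
      ← historyMean_sum]
    congr 1
    funext h
    rw [hm, Finset.mul_sum]
    exact Finset.sum_congr rfl fun G _ => by ring
  have hm1 : historyMean fairWeight alg arrival t m = 1 := by
    have := hmix fun _ => 1
    simp only [historyMean_const (sum_hidingWeight v δ p _), mul_one, sum_goodPrior,
      one_mul] at this
    exact this.symm
  rw [hmix, ← historyMean_sum]
  -- Adding 1 on the left and `m` on the right costs nothing, as both have mean 1. It makes the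
  -- inequality hold pointwise without a bound on `m` when hiding fails: there f m ≤ m, and the
  -- indicators sum to at least 1.
  have key : historyMean fairWeight alg arrival t (fun h => f h * m h + 1) ≤
      historyMean fairWeight alg arrival t (fun h => (f h +
        ∑ i, (Set.indicator {h | ¬ Hideable v δ p i h} (1 : BanditHistory S A L → ℝ) h)) +
          m h) := by
    refine historyMean_mono fairWeight_nonneg t fun h => ?_
    have hind : ∀ i, 0 ≤ Set.indicator {h | ¬ Hideable v δ p i h}
        (1 : BanditHistory S A L → ℝ) h :=
      fun i => Set.indicator_nonneg (fun _ _ => zero_le_one) h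
    by_cases hall : ∀ i, Hideable v δ p i h
    · have : m h = 1 := by
        rw [hmprod]
        exact Finset.prod_eq_one fun i _ => mixture_eq_one v h0 h1 hp1 i h (hall i)
      rw [this]
      have := Finset.sum_nonneg fun i (_ : i ∈ Finset.univ) => hind i
      linarith
    · obtain ⟨i, hi⟩ := not_forall.mp hall
      have h2 := Finset.single_le_sum (fun j _ => hind j) (Finset.mem_univ i)
      rw [Set.indicator_of_mem (show h ∈ {h | ¬ Hideable v δ p i h} from hi)] at h2
      have h3 : f h * m h ≤ m h := mul_le_of_le_one_left (hm0 h) (hf1 h)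
      have h4 := hf0 h
      simp only [Pi.one_apply] at h2
      linarith
  rw [historyMean_add, historyMean_add, historyMean_add, hm1,
    historyMean_const sum_fairWeight] at key
  linarith

/-- Since 1 ± δ ≤ exp(±δ), a threshold for the likelihood ratio becomes one for a ±1 walk. -/
theorem plantedRatio_le_exp_score (v : Fin S → Fin A) {δ : ℝ} (h0 : 0 < δ) (h1 : δ ≤ 1)
    (i : Fin L) (h : BanditHistory S A L) :
    plantedRatio v δ i h ≤ Real.exp (δ * score i v h) := by
  induction h with
  | nil => simp [plantedRatio, score]
  | cons x h ih =>
    simp only [plantedRatio, score, mul_add, Real.exp_add]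
    refine mul_le_mul ih ?_ (by split_ifs <;> linarith) (Real.exp_pos _).le
    split_ifs
    · linarith [Real.add_one_le_exp (δ * 1)]
    · linarith [Real.add_one_le_exp (δ * -1)]
    · simp

/-- Failure gives exp(−p + δ · score + δ) > 1, and δ ≤ p/2 leaves δ · score > p/2. -/
theorem exists_score_gt_of_not_hideable (v : Fin S → Fin A) {δ p : ℝ} (h0 : 0 < δ) (h1 : δ ≤ 1)
    (hδp : δ ≤ p / 2) (i : Fin L) {h : BanditHistory S A L}
    (hh : ¬ Hideable v δ p i h) : ∃ h', h' <:+ h ∧ p / (2 * δ) < score i v h' := by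
  simp only [Hideable, not_forall, not_le] at hh
  obtain ⟨h', hs, hlt⟩ := hh
  refine ⟨h', hs, ?_⟩
  have hexp : (1 - p) * plantedRatio v δ i h' * (1 + δ) ≤
      Real.exp (-p) * Real.exp (δ * score i v h') * Real.exp δ := by
    have e1 : 1 - p ≤ Real.exp (-p) := by linarith [Real.add_one_le_exp (-p)]
    have e2 : 1 + δ ≤ Real.exp δ := by linarith [Real.add_one_le_exp δ]
    have e3 := plantedRatio_le_exp_score v h0 h1 i h'
    have e4 := plantedRatio_nonneg v h0 h1 i h'
    gcongr
  rw [← Real.exp_add, ← Real.exp_add] at hexp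
  have h2 := Real.one_lt_exp_iff.mp (hlt.trans_le hexp)
  rw [div_lt_iff₀ (by linarith)]
  linarith

end HardSystem

/-! ### Near-optimal policies of a planted bandit must know the planted actions. -/

section Policies

variable {S A L : ℕ}

theorem BernoulliBandit.continuous_value (B : BernoulliBandit S A) : Continuous B.value := by
  unfold BernoulliBandit.value
  refine continuous_finsetSum _ fun s _ => continuous_const.mul
    (continuous_finsetSum _ fun a _ => Continuous.mul ?_ continuous_const)
  exact (continuous_apply a).comp (continuous_subtype_val.comp (continuous_apply s))

theorem BernoulliBandit.value_le_optValue (B : BernoulliBandit S A) (π : BanditPolicy S A) :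
    B.value π ≤ B.optValue :=
  le_ciSup (isCompact_range B.continuous_value).bddAbove π

theorem plantedBandit_value [NeZero S] (v : Fin S → Fin A) {δ : ℝ} (h0 : 0 < δ) (h1 : δ ≤ 1)
    (π : BanditPolicy S A) :
    (plantedBandit v δ).value π = 1 / 2 + δ / 2 * ((S : ℝ)⁻¹ * ∑ s, (π s).1 (v s)) := by
  have hS : (S : ℝ) ≠ 0 := Nat.cast_ne_zero.mpr (NeZero.ne S)
  have hin : ∀ s, ∑ a, (π s).1 a * (plantedBandit v δ).mean s a =
      1 / 2 + δ / 2 * (π s).1 (v s) := by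
    intro s
    have hmean : ∀ a, (π s).1 a * (plantedBandit v δ).mean s a =
        (π s).1 a * (1 / 2) + if a = v s then δ / 2 * (π s).1 a else 0 := by
      intro a
      rw [BernoulliBandit.mean, plantedBandit_rewardLaw_toReal v h0 h1]
      simp only [if_true]
      split_ifs <;> ring
    simp only [hmean, Finset.sum_add_distrib, ← Finset.sum_mul, (π s).2.2]
    simp
  have hctx : ∀ s, ((plantedBandit v δ).contextLaw s).toReal = (S : ℝ)⁻¹ := by
    intro s
    simp [plantedBandit]
  simp only [BernoulliBandit.value, hin, hctx, mul_add, Finset.sum_add_distrib, Finset.mul_sum]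
  congr 1
  · simp only [Finset.sum_const, Finset.card_univ, Fintype.card_fin, nsmul_eq_mul]
    field_simp
  · exact Finset.sum_congr rfl fun s _ => by ring

/-- A near-optimal policy plays the planted actions half of the time. -/
theorem half_le_of_mem_nearOptimal [NeZero S] (v : Fin S → Fin A) {ε : ℝ} (h0 : 0 < ε)
    (h1 : 4 * ε ≤ 1) {π : BanditPolicy S A} (hπ : π ∈ (plantedBandit v (4 * ε)).nearOptimal ε) :
    1 / 2 ≤ (S : ℝ)⁻¹ * ∑ s, (π s).1 (v s) := by
  have hS : (S : ℝ) ≠ 0 := Nat.cast_ne_zero.mpr (NeZero.ne S)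
  let π' : BanditPolicy S A := fun s => ⟨Pi.single (v s) 1, single_mem_stdSimplex ℝ (v s)⟩
  have hopt := (plantedBandit v (4 * ε)).value_le_optValue π'
  have hπ' : (plantedBandit v (4 * ε)).optValue - (plantedBandit v (4 * ε)).value π ≤ ε := hπ
  rw [plantedBandit_value v (by linarith) h1] at hopt hπ'
  have : (S : ℝ)⁻¹ * ∑ s, (π' s).1 (v s) = 1 := by
    simp [π', hS]
  rw [this] at hopt
  -- For δ = 4ε the loss of π is at least 2ε(1 − average weight on planted actions).
  by_contra hcon
  nlinarith [mul_lt_mul_of_pos_left (not_le.mp hcon) h0]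

/-- The average, over the planted actions, of the weight a policy gives them. -/
theorem sum_sum_policy_apply [NeZero A] (π : BanditPolicy S A) :
    (A : ℝ) * ∑ v : Fin S → Fin A, ∑ s, (π s).1 (v s) = S * (A : ℝ) ^ S := by
  have hs : ∀ s, (A : ℝ) * ∑ v : Fin S → Fin A, (π s).1 (v s) = (A : ℝ) ^ S := by
    intro s
    calc (A : ℝ) * ∑ v : Fin S → Fin A, (π s).1 (v s)
        = ∑ a : Fin A, ∑ v : Fin S → Fin A, (π s).1 (v s) := by simp
      -- Cyclic shifts permute the assignments `v`; summed over all shifts, the weights at `s` add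
      -- up to 1.
      _ = ∑ a : Fin A, ∑ v : Fin S → Fin A, (π s).1 (v s + a) :=
          Finset.sum_congr rfl fun a _ =>
            (Equiv.sum_comp (Equiv.addRight (fun _ : Fin S => a))
              fun v : Fin S → Fin A => (π s).1 (v s)).symm
      _ = ∑ v : Fin S → Fin A, ∑ a : Fin A, (π s).1 (v s + a) := Finset.sum_comm
      _ = ∑ v : Fin S → Fin A, (1 : ℝ) :=
          Finset.sum_congr rfl fun v _ =>
            (Equiv.sum_comp (Equiv.addLeft (v s)) fun a => (π s).1 a).trans (π s).2.2
      _ = (A : ℝ) ^ S := by simp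
  rw [Finset.sum_comm, Finset.mul_sum]
  simp [hs]

/-- A random policy is near-optimal for few planted bandits. -/
theorem sum_measure_nearOptimal_le [NeZero S] [NeZero A] {ε : ℝ} (h0 : 0 < ε) (h1 : 4 * ε ≤ 1)
    (P : ProbabilityMeasure (BanditPolicy S A)) :
    ∑ v : Fin S → Fin A,
        ((P : Measure (BanditPolicy S A)) ((plantedBandit v (4 * ε)).nearOptimal ε)).toReal ≤
      (A : ℝ) ^ S * (2 / A) := by
  have hS : (0 : ℝ) < S := Nat.cast_pos.mpr (Nat.pos_of_ne_zero (NeZero.ne S))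
  have hA : (0 : ℝ) < A := Nat.cast_pos.mpr (Nat.pos_of_ne_zero (NeZero.ne A))
  set g : (Fin S → Fin A) → BanditPolicy S A → ℝ :=
    fun v π => 2 * (S : ℝ)⁻¹ * ∑ s, (π s).1 (v s) with hg
  have hgm : ∀ v, Measurable (g v) := fun v =>
    (Finset.measurable_sum _ fun s _ =>
      (measurable_pi_apply (v s)).comp (measurable_subtype_coe.comp (measurable_pi_apply s))
        ).const_mul _
  have hg0 : ∀ v π, 0 ≤ g v π := fun v π =>
    mul_nonneg (by positivity) (Finset.sum_nonneg fun s _ => (π s).2.1 _)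
  have hgsum : ∀ π, ∑ v, g v π = (A : ℝ) ^ S * (2 / A) := by
    intro π
    simp only [hg, ← Finset.mul_sum]
    have := sum_sum_policy_apply π
    field_simp
    linarith
  have hle : ∀ v, (P : Measure (BanditPolicy S A)) ((plantedBandit v (4 * ε)).nearOptimal ε) ≤
      ∫⁻ π, ENNReal.ofReal (g v π) ∂P := by
    intro v
    -- Markov's inequality for `g v`, which is at least 1 on near-optimal policies. Passing to this
    -- larger set makes measurability of `nearOptimal` irrelevant.
    refine le_trans (measure_mono (t := {π | 1 ≤ ENNReal.ofReal (g v π)}) fun π hπ => ?_) ?_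
    · have := half_le_of_mem_nearOptimal v h0 h1 hπ
      refine ENNReal.one_le_ofReal.mpr ?_
      simp only [hg]
      linarith
    · have := mul_meas_ge_le_lintegral (μ := (P : Measure (BanditPolicy S A)))
        (hgm v).ennreal_ofReal 1
      rwa [one_mul] at this
  rw [← ENNReal.toReal_sum fun v _ => measure_ne_top _ _]
  refine ENNReal.toReal_le_of_le_ofReal (by positivity) ?_
  calc _ ≤ ∑ v, ∫⁻ π, ENNReal.ofReal (g v π) ∂P := Finset.sum_le_sum fun v _ => hle v
    _ = ∫⁻ π, ∑ v, ENNReal.ofReal (g v π) ∂P :=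
        (lintegral_finsetSum _ fun v _ => (hgm v).ennreal_ofReal).symm
    _ = ∫⁻ _, ENNReal.ofReal ((A : ℝ) ^ S * (2 / A)) ∂P := by
        refine lintegral_congr fun π => ?_
        rw [← ENNReal.ofReal_sum_of_nonneg fun v _ => hg0 v π, hgsum]
    _ = ENNReal.ofReal ((A : ℝ) ^ S * (2 / A)) := by simp

end Policies

/-! ### Choice of constants. -/

section Parameters

/-- The choice of constants: a score of `x` is unlikely, either because of the number of hits it
needs, or by sub-Gaussian concentration. -/
theorem exists_constants (β η : ℝ) (hη : 0 < η) (hηβ : η < β / 2) :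
    ∃ c : ℝ, 0 < c ∧ c ≤ 1 / 16 ∧ ∀ D : ℝ, 0 < D → ∃ m₀ : ℕ, 50 ≤ m₀ ∧ ∀ m : ℝ, (m₀ : ℝ) ≤ m →
      1 ≤ Real.log m ∧ ∀ l x : ℝ, 0 ≤ l → l ≤ m ^ η →
        1 + l / Real.log m ≤ 16 * c * x →
        (l + 5 ≤ Real.log (1 + 1 / (D * m ^ (-β) * x ^ 2)) * x) ∨
        (l + 5 ≤ Real.log (1 + 1 / (D * m ^ (-β) * x ^ 2)) * (x ^ 2 / (2 * (l + 5)))) := by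
  set γ : ℝ := β - 2 * η with hγ
  have hγ0 : 0 < γ := by linarith
  -- The bound γ/32 gives 16c ≤ γ/2, the power of `m` gained for small `x`; the bound 1/16 later
  -- gives 16ε ≤ α.
  refine ⟨min (γ / 32) (1 / 16), by positivity, min_le_right _ _, fun D hD => ?_⟩
  have ht1 := (tendsto_rpow_atTop (show 0 < γ / 2 by linarith)).eventually_ge_atTop
    (144 * D + 1)
  have ht2 := Real.tendsto_log_atTop.eventually_ge_atTop 5
  obtain ⟨M, hM⟩ := Filter.eventually_atTop.mp (ht1.and ht2)
  refine ⟨max 50 ⌈M⌉₊, le_max_left _ _, fun m hm => ?_⟩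
  have hmM : M ≤ m := (Nat.le_ceil M).trans ((Nat.cast_le.mpr (le_max_right _ _)).trans hm)
  have hm50 : (50 : ℝ) ≤ m := by
    have : ((50 : ℕ) : ℝ) ≤ m := (Nat.cast_le.mpr (le_max_left _ _)).trans hm
    exact_mod_cast this
  obtain ⟨hpow, hlog⟩ := hM m hmM
  have hm0 : 0 < m := by linarith
  refine ⟨by linarith, fun l x hl hlm hx => ?_⟩
  set lm : ℝ := Real.log m with hlm_def
  set Λ : ℝ := l + 5 with hΛ
  have hlm0 : 0 < lm := by linarith
  have hx0 : 0 < x := by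
    have : 0 < 16 * min (γ / 32) (1 / 16) * x := lt_of_lt_of_le (by positivity) hx
    exact pos_of_mul_pos_right this (by positivity)
  have hmη : 1 ≤ m ^ η := Real.one_le_rpow (by linarith) hη.le
  have hΛ6 : Λ ≤ 6 * m ^ η := by linarith
  have hΛ0 : 0 < Λ := by linarith
  -- the scale of the number of hits
  have hscale : 144 * D * m ^ (-β) * (m ^ η) ^ 2 ≤ m ^ (-(γ / 2)) := by
    have e1 : m ^ (-β) * (m ^ η) ^ 2 = m ^ (-(γ / 2)) * m ^ (-(γ / 2)) := by
      rw [← Real.rpow_natCast, ← Real.rpow_mul hm0.le, ← Real.rpow_add hm0, ← Real.rpow_add hm0]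
      congr 1
      rw [hγ]; push_cast; ring
    have e2 : m ^ (-(γ / 2)) * m ^ (γ / 2) = 1 := by
      rw [← Real.rpow_add hm0]; simp
    have e3 : 0 < m ^ (-(γ / 2)) := Real.rpow_pos_of_pos hm0 _
    calc 144 * D * m ^ (-β) * (m ^ η) ^ 2 = 144 * D * (m ^ (-β) * (m ^ η) ^ 2) := by ring
      _ = (144 * D * m ^ (-(γ / 2))) * m ^ (-(γ / 2)) := by rw [e1]; ring
      _ ≤ 1 * m ^ (-(γ / 2)) := by
          gcongr
          nlinarith
      _ = _ := one_mul _
  have hE : 0 < D * m ^ (-β) := mul_pos hD (Real.rpow_pos_of_pos hm0 _)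
  -- The gap between β and 2η is spent here: Λ² costs at most 36 m^(2η).
  have hEΛ : 4 * (D * m ^ (-β)) * Λ ^ 2 ≤ m ^ (-(γ / 2)) := by
    calc 4 * (D * m ^ (-β)) * Λ ^ 2 ≤ 4 * (D * m ^ (-β)) * (6 * m ^ η) ^ 2 := by gcongr
      _ = 144 * D * m ^ (-β) * (m ^ η) ^ 2 := by ring
      _ ≤ _ := hscale
  set E : ℝ := D * m ^ (-β) with hE_def
  have hEx : 0 < E * x ^ 2 := by positivity
  -- For small `x` the scale R = E x² is at most m^(−γ/2), so each of the `x` required hits costs a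
  -- factor m^(−γ/2). For large `x` the walk may take x²/(2Λ) steps before its Gaussian tail exceeds
  -- exp(−Λ), and that many hits are unlikely.
  rcases le_or_gt x (2 * Λ) with hcase | hcase
  · left
    have h1 : E * x ^ 2 ≤ m ^ (-(γ / 2)) := by
      calc E * x ^ 2 ≤ E * (2 * Λ) ^ 2 := by gcongr
        _ = 4 * E * Λ ^ 2 := by ring
        _ ≤ _ := hEΛ
    have h2 : m ^ (γ / 2) ≤ 1 + 1 / (E * x ^ 2) := by
      have : 1 / m ^ (-(γ / 2)) ≤ 1 / (E * x ^ 2) := one_div_le_one_div_of_le hEx h1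
      rw [Real.rpow_neg hm0.le, one_div, inv_inv] at this
      linarith
    have h3 : γ / 2 * lm ≤ Real.log (1 + 1 / (E * x ^ 2)) := by
      rw [hlm_def, ← Real.log_rpow hm0]
      exact Real.log_le_log (Real.rpow_pos_of_pos hm0 _) h2
    have h4 : 1 + l / lm ≤ γ / 2 * x := by
      refine hx.trans ?_
      have : min (γ / 32) (1 / 16) ≤ γ / 32 := min_le_left _ _
      nlinarith
    calc l + 5 ≤ lm * (1 + l / lm) := by
          rw [mul_add, mul_div_cancel₀ _ hlm0.ne']; linarith
      _ ≤ lm * (γ / 2 * x) := by gcongr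
      _ = γ / 2 * lm * x := by ring
      _ ≤ _ := by gcongr
  · right
    rcases le_or_gt (E * x ^ 2) 1 with hR | hR
    · have h1 : 1 / 2 ≤ Real.log (1 + 1 / (E * x ^ 2)) := by
        have : (2 : ℝ) ≤ 1 + 1 / (E * x ^ 2) := by
          have := one_div_le_one_div_of_le hEx hR
          linarith
        have h2 := Real.log_le_log (by norm_num) this
        linarith [Real.log_two_gt_d9]
      calc Λ = 1 / 2 * ((2 * Λ) ^ 2 / (2 * Λ)) := by field_simp
        _ ≤ Real.log (1 + 1 / (E * x ^ 2)) * (x ^ 2 / (2 * Λ)) := by gcongr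
    · have h1 : 1 / (2 * (E * x ^ 2)) ≤ Real.log (1 + 1 / (E * x ^ 2)) := by
        have h2 := Real.one_sub_inv_le_log_of_pos (show 0 < 1 + 1 / (E * x ^ 2) by positivity)
        refine le_trans ?_ h2
        have h3 : 1 - (1 + 1 / (E * x ^ 2))⁻¹ = 1 / (E * x ^ 2 + 1) := by
          field_simp; ring
        rw [h3]
        exact one_div_le_one_div_of_le (by linarith) (by linarith)
      have h2 : 4 * E * Λ ^ 2 ≤ 1 :=
        hEΛ.trans (Real.rpow_le_one_of_one_le_of_nonpos (by linarith) (by linarith))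
      calc Λ ≤ 1 / (4 * E * Λ) := by
            rw [le_div_iff₀ (by positivity)]; linarith
        _ = 1 / (2 * (E * x ^ 2)) * (x ^ 2 / (2 * Λ)) := by field_simp; ring
        _ ≤ _ := by gcongr

end Parameters

/-! ### Averaging over planted actions and good users, and the theorem. -/

section LowerBound

variable {S A L : ℕ}

theorem successProb_hidingSystem [NeZero S] (v : Fin S → Fin A) (δ p ε : ℝ) (G : Finset (Fin L))
    (alg : BanditAlgorithm S A L) (arrival : ℕ → Fin L) (t : ℕ) :
    (hidingSystem v δ p G).successProb alg arrival t ε =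
      ENNReal.ofReal (historyMean (hidingWeight v δ p G) alg arrival t fun h =>
        ((alg.output h : Measure (BanditPolicy S A))
          ((plantedBandit v δ).nearOptimal ε)).toReal) := by
  rw [← MultiUserSystem.tsum_historyLaw (w := hidingWeight v δ p G) (hidingSystem v δ p G) (fun h i s => ?_)
    (fun _ _ _ _ _ => rfl) t _ fun h => ENNReal.toReal_nonneg]
  · simp only [ENNReal.ofReal_toReal (measure_ne_top _ _)]
    rfl
  · simp [MultiUserSystem.contextStep, hidingSystem, plantedBandit]

/-- For most planted actions, a user stays hideable. -/
theorem sum_historyMean_not_hideable_le [NeZero S] [NeZero A] {δ p R l : ℝ} (h0 : 0 < δ)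
    (h1 : δ ≤ 1) (hδp : δ ≤ p / 2) (hR : 0 < R) (hl : 0 < l) (alg : BanditAlgorithm S A L)
    (arrival : ℕ → Fin L) (t : ℕ) (i : Fin L)
    (hN : (numInteractions arrival t i : ℝ) ≤ min (S : ℝ) A * R)
    (hparam : l ≤ Real.log (1 + 1 / R) * (p / (2 * δ)) ∨
      l ≤ Real.log (1 + 1 / R) * ((p / (2 * δ)) ^ 2 / (2 * l))) :
    ∑ v : Fin S → Fin A, historyMean fairWeight alg arrival t
        (Set.indicator {h | ¬ Hideable v δ p i h} 1) ≤
      (A : ℝ) ^ S * (Real.exp (2 - l) + Real.exp (-l)) := by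
  set x : ℝ := p / (2 * δ) with hx
  have hx0 : 0 < x := div_pos (by linarith) (by linarith)
  have hy : 1 ≤ 1 + 1 / R := by
    have : 0 < 1 / R := by positivity
    linarith
  -- The base 1 + 1/R is the largest for which N(y − 1) ≤ min(S, A) follows from the budget.
  have hNR : numInteractions arrival t i * (1 + 1 / R - 1) ≤ min (S : ℝ) A := by
    rw [add_sub_cancel_left, mul_one_div, div_le_iff₀ hR]
    exact hN
  have hNS := hNR.trans (min_le_left _ _)
  have hNA := hNR.trans (min_le_right _ _)
  have hscore : ∀ v : Fin S → Fin A, historyMean fairWeight alg arrival t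
        (Set.indicator {h | ¬ Hideable v δ p i h} 1) ≤ historyMean fairWeight alg arrival t
        (Set.indicator {h | ∃ h', h' <:+ h ∧ x < score i v h'} 1) := fun v =>
    historyMean_mono fairWeight_nonneg t fun h => Set.indicator_le_indicator_of_subset
      (fun h hh => exists_score_gt_of_not_hideable v h0 h1 hδp i hh) (fun _ => zero_le_one) h
  have hA : (0 : ℝ) ≤ (A : ℝ) ^ S := by positivity
  rcases hparam with hp | hp
  · calc _ ≤ ∑ v : Fin S → Fin A, historyMean fairWeight alg arrival t
          (Set.indicator {h | x ≤ hitCount i v h} 1) := Finset.sum_le_sum fun v _ =>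
          (hscore v).trans (historyMean_exists_score_gt_le_hitCount i v x t)
      _ ≤ (A : ℝ) ^ S * Real.exp (2 - Real.log (1 + 1 / R) * x) :=
          sum_historyMean_le_hitCount i hy t hNS hNA
      _ ≤ _ := by
          refine mul_le_mul_of_nonneg_left ?_ hA
          have := Real.exp_le_exp.mpr
            (show 2 - Real.log (1 + 1 / R) * x ≤ 2 - l by linarith)
          linarith [Real.exp_pos (-l)]
  -- With this number of hits the sub-Gaussian tail is exactly exp(−l).
  · set K : ℝ := x ^ 2 / (2 * l) with hK
    have hK0 : 0 < K := by positivity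
    have hxK : x ^ 2 / (2 * K) = l := by rw [hK]; field_simp
    calc _ ≤ ∑ v : Fin S → Fin A, (historyMean fairWeight alg arrival t
          (Set.indicator {h | K ≤ hitCount i v h} 1) + Real.exp (-l)) :=
          Finset.sum_le_sum fun v _ => (hscore v).trans (by
            have := historyMean_exists_score_gt_le (alg := alg) (arrival := arrival) i v hx0 hK0 t
            rwa [hxK] at this)
      _ ≤ (A : ℝ) ^ S * Real.exp (2 - Real.log (1 + 1 / R) * K) +
            (A : ℝ) ^ S * Real.exp (-l) := by
          rw [Finset.sum_add_distrib]
          refine add_le_add (sum_historyMean_le_hitCount i hy t hNS hNA) (le_of_eq ?_)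
          simp
      _ ≤ _ := by
          rw [← mul_add]
          gcongr

/-- If all users stay hideable for most planted actions, then some hiding system with few bad
users defeats the algorithm. -/
theorem exists_successProb_hidingSystem_le [NeZero S] [NeZero A] (hA50 : 50 ≤ A) {α ε : ℝ}
    (hα1 : α ≤ 1) (hε : 0 < ε) (hε1 : 16 * ε ≤ α) (alg : BanditAlgorithm S A L)
    (arrival : ℕ → Fin L) (t : ℕ) {b : ℝ} (hb : L * b ≤ 1 / 5)
    (hhide : ∀ i : Fin L, ∑ v : Fin S → Fin A, historyMean fairWeight alg arrival t
        (Set.indicator {h | ¬ Hideable v (4 * ε) (α / 2) i h} 1) ≤ (A : ℝ) ^ S * b) :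
    ∃ (v : Fin S → Fin A) (G : Finset (Fin L)), (1 - α) * (L : ℝ) ≤ G.card ∧
      (hidingSystem v (4 * ε) (α / 2) G).successProb alg arrival t ε ≤ 2 / 3 := by
  by_contra! hcon
  have hL : 0 < L := (arrival 0).pos
  have hα : 0 < α := by linarith
  have hA : (50 : ℝ) ≤ A := by exact_mod_cast hA50
  have hAS : (0 : ℝ) < (A : ℝ) ^ S := by positivity
  set f : (Fin S → Fin A) → BanditHistory S A L → ℝ := fun v h =>
    ((alg.output h : Measure (BanditPolicy S A))
      ((plantedBandit v (4 * ε)).nearOptimal ε)).toReal with hf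
  have hf0 : ∀ v h, 0 ≤ f v h := fun v h => ENNReal.toReal_nonneg
  have hf1 : ∀ v h, f v h ≤ 1 := fun v h => by
    refine ENNReal.toReal_le_of_le_ofReal zero_le_one ?_
    rw [ENNReal.ofReal_one]
    exact prob_le_one
  have hprior : ∀ G : Finset (Fin L), 0 ≤ goodPrior (α / 2) G :=
    goodPrior_nonneg (by linarith) (by linarith)
  have hw0 : ∀ v : Fin S → Fin A, ∀ G : Finset (Fin L), ∀ h i s a r,
      0 ≤ hidingWeight v (4 * ε) (α / 2) G h i s a r := fun v G h i s a r =>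
    ENNReal.toReal_nonneg
  have hlow : ∀ v, 1 / 3 ≤ ∑ G : Finset (Fin L), goodPrior (α / 2) G *
      historyMean (hidingWeight v (4 * ε) (α / 2) G) alg arrival t (f v) := by
    intro v
    calc (1 / 3 : ℝ) = 1 / 2 * (2 / 3) := by norm_num
      _ ≤ (∑ G : Finset (Fin L) with (1 - α) * (L : ℝ) ≤ G.card, goodPrior (α / 2) G) *
          (2 / 3) := by
          gcongr
          exact half_le_sum_goodPrior hα hα1 hL
      _ ≤ ∑ G : Finset (Fin L) with (1 - α) * (L : ℝ) ≤ G.card, goodPrior (α / 2) G *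
          historyMean (hidingWeight v (4 * ε) (α / 2) G) alg arrival t (f v) := by
          rw [Finset.sum_mul]
          refine Finset.sum_le_sum fun G hG => mul_le_mul_of_nonneg_left ?_ (hprior G)
          have := hcon v G (Finset.mem_filter.mp hG).2
          rw [successProb_hidingSystem] at this
          have h23 : (2 / 3 : ℝ≥0∞) = ENNReal.ofReal (2 / 3) := by
            rw [ENNReal.ofReal_div_of_pos (by norm_num)]
            simp
          rw [h23] at this
          exact (ENNReal.ofReal_lt_ofReal_iff'.mp this).1.le
      _ ≤ _ := by
          refine Finset.sum_le_sum_of_subset_of_nonneg (Finset.filter_subset _ _) fun G _ _ => ?_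
          refine mul_nonneg (hprior G) ?_
          rw [← historyMean_zero (w := hidingWeight v (4 * ε) (α / 2) G) (alg := alg)
            (arrival := arrival) t]
          exact historyMean_mono (hw0 v G) t (hf0 v)
  have hup : ∑ v, ∑ G : Finset (Fin L), goodPrior (α / 2) G *
      historyMean (hidingWeight v (4 * ε) (α / 2) G) alg arrival t (f v) ≤
      (A : ℝ) ^ S * (2 / A) + L * ((A : ℝ) ^ S * b) := by
    calc _ ≤ ∑ v, (historyMean fairWeight alg arrival t (f v) +
        ∑ i, historyMean fairWeight alg arrival t
          (Set.indicator {h | ¬ Hideable v (4 * ε) (α / 2) i h} 1)) :=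
          Finset.sum_le_sum fun v _ => sum_goodPrior_mul_historyMean_le v (by linarith)
            (by linarith) (by linarith) (by linarith) alg arrival t (hf0 v) (hf1 v)
      -- The fair law does not depend on `v`, so the sum over `v` moves inside and meets one fixed
      -- output at a time.
      _ = historyMean fairWeight alg arrival t (fun h => ∑ v, f v h) +
        ∑ i, ∑ v : Fin S → Fin A, historyMean fairWeight alg arrival t
          (Set.indicator {h | ¬ Hideable v (4 * ε) (α / 2) i h} 1) := by
          rw [Finset.sum_add_distrib, historyMean_sum, Finset.sum_comm (γ := Fin L)]
      _ ≤ historyMean fairWeight alg arrival t (fun _ => (A : ℝ) ^ S * (2 / A)) +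
        ∑ _i : Fin L, (A : ℝ) ^ S * b :=
          add_le_add (historyMean_mono fairWeight_nonneg t fun h =>
            sum_measure_nearOptimal_le hε (by linarith) (alg.output h))
            (Finset.sum_le_sum fun i _ => hhide i)
      _ = _ := by
          rw [historyMean_const sum_fairWeight]
          simp
  have hlow' := Finset.sum_le_sum fun v (_ : v ∈ Finset.univ) => hlow v
  have hcount : ∑ _v : Fin S → Fin A, (1 / 3 : ℝ) = (A : ℝ) ^ S * (1 / 3) := by simp
  rw [hcount] at hlow'
  have h25 : 2 / (A : ℝ) ≤ 1 / 25 := by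
    rw [div_le_div_iff₀ (by linarith) (by norm_num)]
    linarith
  have htot : (A : ℝ) ^ S * (2 / A) + L * ((A : ℝ) ^ S * b) ≤ (A : ℝ) ^ S * (6 / 25) := by
    calc _ = (A : ℝ) ^ S * (2 / A + L * b) := by ring
      _ ≤ _ := by gcongr; linarith
  nlinarith

/-- The union bound over users; the shift by 5 leaves e⁻³ + e⁻⁵ ≤ 1/8 + 1/32. -/
theorem mul_exp_log_bound (hL : 0 < L) :
    (L : ℝ) * (Real.exp (2 - (Real.log L + 5)) + Real.exp (-(Real.log L + 5))) ≤ 1 / 5 := by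
  have hL' : (0 : ℝ) < L := Nat.cast_pos.mpr hL
  have h2 : 2 ≤ Real.exp 1 := by linarith [Real.add_one_le_exp (1 : ℝ)]
  have h3 : Real.exp (-3) ≤ 1 / 8 := by
    rw [Real.exp_neg, ← one_div]
    refine one_div_le_one_div_of_le (by norm_num) ?_
    have := pow_le_pow_left₀ (by norm_num) h2 3
    rw [← Real.exp_nat_mul] at this
    norm_num at this
    exact this
  have h5 : Real.exp (-5) ≤ 1 / 32 := by
    rw [Real.exp_neg, ← one_div]
    refine one_div_le_one_div_of_le (by norm_num) ?_
    have := pow_le_pow_left₀ (by norm_num) h2 5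
    rw [← Real.exp_nat_mul] at this
    norm_num at this
    exact this
  rw [show 2 - (Real.log L + 5) = -3 - Real.log L by ring,
    show -(Real.log L + 5) = -5 - Real.log L by ring, Real.exp_sub, Real.exp_sub,
    Real.exp_log hL', ← add_div, mul_div_cancel₀ _ hL'.ne']
  linarith

end LowerBound

theorem mainTheorem1 (β η : ℝ) (hη : 0 < η) (hηβ : η < β / 2) :
    ∃ c : ℝ, 0 < c ∧ ∀ C : ℝ, 0 < C → ∃ m₀ : ℕ,
      ∀ (S A L : ℕ) (α ε : ℝ), m₀ ≤ min S A → α < 1 / 3 → 0 < ε →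
        Real.log L ≤ (min S A : ℝ) ^ η →
        ε * (1 + Real.log L / Real.log (min S A : ℝ)) ≤ c * α →
        ∃ 𝓗 : Set (MultiUserSystem S A L),
          (∀ M ∈ 𝓗, M.IsCorrupted α ∧ ∀ s, M.bandit.contextLaw s = (S : ℝ≥0∞)⁻¹) ∧
          ∀ (arrival : ℕ → Fin L) (T : ℕ) (alg : BanditAlgorithm S A L),
            (∀ i, (numInteractions arrival T i : ℝ) ≤
              C * (min S A : ℝ) ^ (1 - β) * α ^ 2 / ε ^ 2) →
            ∃ M ∈ 𝓗, M.successProb alg arrival T ε ≤ 2 / 3 := by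
  obtain ⟨c, hc, hc16, hparam⟩ := exists_constants β η hη hηβ
  refine ⟨c, hc, fun C hC => ?_⟩
  -- The factor 256 = 16² rewrites α²/ε² as 256 x² with x = α/(16ε).
  obtain ⟨m₀, hm₀, hparam⟩ := hparam (256 * C) (by positivity)
  refine ⟨m₀, fun S A L α ε hm hα hε hlogL hεα => ?_⟩
  have hS : m₀ ≤ S := hm.trans (min_le_left _ _)
  have hA : m₀ ≤ A := hm.trans (min_le_right _ _)
  have : NeZero S := ⟨by omega⟩
  have : NeZero A := ⟨by omega⟩
  have hmin : (m₀ : ℝ) ≤ min (S : ℝ) A := le_min (Nat.cast_le.mpr hS) (Nat.cast_le.mpr hA)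
  obtain ⟨hlog, hparam⟩ := hparam _ hmin
  refine ⟨{M | ∃ v G, (1 - α) * (L : ℝ) ≤ G.card ∧ M = hidingSystem v (4 * ε) (α / 2) G},
    ?_, fun arrival T alg hN => ?_⟩
  · rintro M ⟨v, G, hG, rfl⟩
    exact ⟨hG, fun s => by simp [hidingSystem, plantedBandit]⟩
  have hL : 0 < L := (arrival 0).pos
  set m : ℝ := min (S : ℝ) A with hm_def
  have hm0 : 0 < m := by
    have : (50 : ℝ) ≤ m₀ := by exact_mod_cast hm₀
    linarith
  have hl0 : 0 ≤ Real.log L := Real.log_natCast_nonneg L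
  have hratio : 0 ≤ Real.log L / Real.log m := div_nonneg hl0 (by linarith)
  have hεc : ε ≤ c * α := le_trans (by nlinarith) hεα
  -- Positivity of α is not assumed; it is forced by ε > 0 and ε ≤ c α.
  have hα0 : 0 < α := pos_of_mul_pos_right (hε.trans_le hεc) hc.le
  have hε16 : 16 * ε ≤ α := by nlinarith
  have hx : α / 2 / (2 * (4 * ε)) = α / (16 * ε) := by
    field_simp; norm_num
  have hpar := hparam (Real.log L) (α / (16 * ε)) hl0 hlogL (by
    rw [show 16 * c * (α / (16 * ε)) = c * α / ε by field_simp, le_div_iff₀ hε]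
    linarith)
  set R : ℝ := 256 * C * m ^ (-β) * (α / (16 * ε)) ^ 2 with hR
  have hmβ : 0 < m ^ (-β) := Real.rpow_pos_of_pos hm0 _
  have hR0 : 0 < R := by positivity
  have hNR : ∀ i, (numInteractions arrival T i : ℝ) ≤ m * R := by
    intro i
    refine (hN i).trans (le_of_eq ?_)
    rw [sub_eq_add_neg, Real.rpow_add hm0, Real.rpow_one, hR]
    field_simp
    norm_num
  obtain ⟨v, G, hG, hle⟩ := exists_successProb_hidingSystem_le (by omega) (by linarith) hε hε16
    alg arrival T (mul_exp_log_bound hL) fun i =>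
      sum_historyMean_not_hideable_le (by linarith) (by linarith) (by linarith) hR0
        (by linarith) alg arrival T i (hNR i) (by rw [hx]; exact hpar)
  exact ⟨_, ⟨v, G, hG, rfl⟩, hle⟩
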